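/- **Theorem (general link functions).** Let $d,d'\ge 0$ and let $L_X:\mathbb{Z}_+^2\to\mathbb{Z}^{d}$, $L_Y:\mathbb{Z}_+^2\to\mathbb{Z}^{d'}$ be link functions, where $\mathbb{Z}_+=\{1,2,\dots\}$. Let $\{x_\alpha\}_{\alpha\in\mathbb{Z}^{d}}$ and $\{y_\beta\}_{\beta\in\mathbb{Z}^{d'}}$ be two families of complex (for instance real) random variables on a probability space $(\Omega,\mathbb{P})$, such that each family consists of independent variables, the two families are independent of each other, $\mathbb{E}x_\alpha=\mathbb{E}y_\beta=0$, $\mathbb{E}|x_\alpha|^2=\mathbb{E}|y_\beta|^2=1$, and $\sup_\alpha\mathbb{E}|x_\alpha|^p<\infty$, $\sup_\beta\mathbb{E}|y_\beta|^p<\infty$ for every $1\le p<\infty$. (The variables of one family need not be identically distributed.) For a link function $L$ put $$\Delta_L=\sup_{n}\sup_{t\in\mathrm{range}(L)}\max\Big\{\sup_{j\in[n]}\#\{i\in[n]: L(i,j)=t\},\ \sup_{i\in[n]}\#\{j\in[n]: L(i,j)=t\}\Big\}.$$ Suppose that $\Delta_{L_X}<\infty$ and $\Delta_{L_Y}<\infty$,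 and that the map $(i,j)\mapsto(L_X(i,j),L_Y(i,j))$ is injective on $\mathbb{Z}_+^2$. Let $X_n=(x_{L_X(i,j)})_{1\le i,j\le n}$ and $Y_n=(y_{L_Y(i,j)})_{1\le i,j\le n}$, and let $\odot$ denote the entrywise product. Then $n^{-1/2}(X_n\odot Y_n)$, as an element of the algebra $\mathcal{M}_n\big(\bigcap_{1\le p<\infty}L^p(\Omega,\mathbb{P})\big)$ with the state $\frac1n\mathbb{E}\,\mathrm{tr}$, converges in $*$-distribution to a circular variable. That is, there are a $*$-probability space $(\mathcal{A},\varphi)$ and an element $c=(s_1+\mathrm{i}s_2)/\sqrt2\in\mathcal{A}$, with $s_1,s_2$ freely independent semi-circular variables, such that for every non-commutative polynomial $Q\in\mathbb{C}\langle X,X^*\rangle$ $$\tfrac1n\,\mathbb{E}\,\mathrm{tr}\,Q(a_n,a_n^*)\longrightarrow\varphi(Q(c,c^*)),\qquad a_n=n^{-1/2}(X_n\odot Y_n).$$ No further non-triviality condition on the equations between values of $L_X$ and $L_Y$ is imposed. -/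

import Mathlib

open MeasureTheory ProbabilityTheory Filter Topology
open scoped ENNReal ComplexOrder

noncomputable section

namespace StarProb

/-! ### Non-commutative probability -/

section Abstract

variable {A : Type*} [Ring A] [StarRing A] [Algebra ℂ A]

/-- A state on a unital `*`-algebra: a unital linear functional which is positive (for the order of
`ℂ`, so `φ (star a * a)` is real and nonnegative). The pair `(A, φ)` is then a `*`-probability
space. -/
structure IsState (φ : A →ₗ[ℂ] ℂ) : Prop where
  map_one : φ 1 = 1
  nonneg : ∀ a : A, 0 ≤ φ (star a * a)

/-- Free independence of a family of unital subalgebras: alternating products of centred elements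
are centred. -/
def FreeSubalgebras {ι : Type*} (φ : A →ₗ[ℂ] ℂ) (S : ι → Subalgebra ℂ A) : Prop :=
  ∀ (k : ℕ), 1 ≤ k → ∀ (i : Fin k → ι) (a : Fin k → A),
    (∀ j, a j ∈ S (i j)) → (∀ j, φ (a j) = 0) →
    (∀ j j' : Fin k, (j : ℕ) + 1 = j' → i j ≠ i j') →
    φ (List.ofFn a).prod = 0

/-- Free independence of a family of elements: the unital subalgebras that they generate are
free. -/
def FreeElements {ι : Type*} (φ : A →ₗ[ℂ] ℂ) (a : ι → A) : Prop :=
  FreeSubalgebras φ fun i => Algebra.adjoin ℂ {a i}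

/-- A semi-circular variable: a self-adjoint element whose even moments are the Catalan numbers and
whose odd moments vanish. -/
structure IsSemicircular (φ : A →ₗ[ℂ] ℂ) (s : A) : Prop where
  isSelfAdjoint : IsSelfAdjoint s
  moment : ∀ k : ℕ, φ (s ^ k) = if Even k then (catalan (k / 2) : ℂ) else 0

/-- A circular variable: `(s₁ + i s₂) / √2` with `s₁`, `s₂` free semi-circular variables. -/
def IsCircular (φ : A →ₗ[ℂ] ℂ) (c : A) : Prop :=
  ∃ s : Fin 2 → A, (∀ i, IsSemicircular φ (s i)) ∧ FreeElements φ s ∧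
    c = ((Real.sqrt 2 : ℂ)⁻¹) • (s 0 + Complex.I • s 1)

/-- The `*`-distribution of `a`: the functional `Q ↦ φ (Q(a, a*))` on the algebra of
non-commutative polynomials in two indeterminates `X` (index `false`) and `X*` (index `true`). -/
def starDistribution (φ : A →ₗ[ℂ] ℂ) (a : A) : FreeAlgebra ℂ Bool →ₗ[ℂ] ℂ :=
  φ ∘ₗ (FreeAlgebra.lift ℂ fun e : Bool => if e then star a else a).toLinearMap

end Abstract

/-- Convergence in `*`-distribution of `a n ∈ (A n, φ n)` to `b ∈ (B, ψ)`. -/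
def ConvergesInStarDistribution {A : ℕ → Type*} [∀ n, Ring (A n)] [∀ n, StarRing (A n)]
    [∀ n, Algebra ℂ (A n)] (φ : ∀ n, A n →ₗ[ℂ] ℂ) (a : ∀ n, A n)
    {B : Type*} [Ring B] [StarRing B] [Algebra ℂ B] (ψ : B →ₗ[ℂ] ℂ) (b : B) : Prop :=
  ∀ Q : FreeAlgebra ℂ Bool,
    Tendsto (fun n => starDistribution (φ n) (a n) Q) atTop (𝓝 (starDistribution ψ b Q))

/-! ### Random matrices -/

section RandomMatrices

variable {Ω : Type*} [MeasurableSpace Ω]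

/-- The `*`-algebra `⋂_{1 ≤ p < ∞} L^p(Ω, P)` of complex random variables with finite moments of
all orders. -/
def LInfMinus (P : Measure Ω) [IsProbabilityMeasure P] : StarSubalgebra ℂ (Ω → ℂ) where
  carrier := {f | ∀ p : ℝ≥0∞, 1 ≤ p → p ≠ ∞ → MemLp f p P}
  mul_mem' := by
    intro f g hf hg p hp hp'
    have h2 : (2 : ℝ≥0∞) * p ≠ ∞ := ENNReal.mul_ne_top (by simp) hp'
    have h1 : 1 ≤ 2 * p := hp.trans (le_mul_of_one_le_left' (by norm_num))
    have : ENNReal.HolderTriple (2 * p) (2 * p) p := ⟨by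
      rw [ENNReal.mul_inv (by simp) (by simp), ← add_mul, ENNReal.inv_two_add_inv_two, one_mul]⟩
    exact (hg _ h1 h2).mul (hf _ h1 h2)
  add_mem' := fun hf hg p hp hp' => (hf p hp hp').add (hg p hp hp')
  algebraMap_mem' := fun c p _ _ => memLp_const c
  star_mem' := fun hf p hp hp' => (hf p hp hp').star

variable (P : Measure Ω) [IsProbabilityMeasure P]

theorem integrable_of_lInfMinus (f : LInfMinus P) : Integrable (f : Ω → ℂ) P :=
  memLp_one_iff_integrable.1 (f.2 1 le_rfl ENNReal.one_ne_top)

/-- The expectation on random variables with finite moments. -/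
def expectation : LInfMinus P →ₗ[ℂ] ℂ where
  toFun f := ∫ ω, (f : Ω → ℂ) ω ∂P
  map_add' f g := integral_add (integrable_of_lInfMinus P f) (integrable_of_lInfMinus P g)
  map_smul' c f := integral_const_mul c (f : Ω → ℂ)

/-- The functional `(1/n) E tr` on the `*`-algebra of `n × n` random matrices. -/
def expTrace (n : ℕ) : Matrix (Fin n) (Fin n) (LInfMinus P) →ₗ[ℂ] ℂ :=
  ((n : ℂ)⁻¹) • (expectation P ∘ₗ Matrix.traceLinearMap (Fin n) ℂ (LInfMinus P))

variable {P}

/-- The patterned matrix `(a_{L(i, j)})` with `1 ≤ i, j ≤ n`. -/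
def patterned {d : ℕ} (L : ℕ+ × ℕ+ → Fin d → ℤ) (a : (Fin d → ℤ) → LInfMinus P) (n : ℕ) :
    Matrix (Fin n) (Fin n) (LInfMinus P) :=
  Matrix.of fun i j => a (L (Nat.succPNat i, Nat.succPNat j))

/-- The matrix `n^{-1/2} (X_n ⊙ Y_n)`, with `⊙` the entrywise product. -/
def scaledProduct {d d' : ℕ} (LX : ℕ+ × ℕ+ → Fin d → ℤ) (LY : ℕ+ × ℕ+ → Fin d' → ℤ)
    (x : (Fin d → ℤ) → LInfMinus P) (y : (Fin d' → ℤ) → LInfMinus P) (n : ℕ) :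
    Matrix (Fin n) (Fin n) (LInfMinus P) :=
  ((Real.sqrt n : ℂ)⁻¹) • Matrix.hadamard (patterned LX x n) (patterned LY y n)

/-- Independent, centred, unit-variance random variables, with the moments of each order bounded
uniformly over the family. -/
structure IsInputFamily {I : Type*} (x : I → LInfMinus P) : Prop where
  indep : iIndepFun (fun α => (x α : Ω → ℂ)) P
  mean_zero : ∀ α, ∫ ω, (x α : Ω → ℂ) ω ∂P = 0
  unit_variance : ∀ α, ∫ ω, ‖(x α : Ω → ℂ) ω‖ ^ 2 ∂P = 1
  moments_bounded : ∀ p : ℕ, ∃ C : ℝ, ∀ α, ∫ ω, ‖(x α : Ω → ℂ) ω‖ ^ p ∂P ≤ C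

end RandomMatrices

/-- The largest number of times that a value of the link function `L` occurs in a row or in a column
of an `n × n` matrix, over all `n`. -/
def maxMultiplicity {d : ℕ} (L : ℕ+ × ℕ+ → Fin d → ℤ) : ℕ∞ :=
  ⨆ (n : ℕ+) (t ∈ Set.range L), max
    (⨆ j ∈ Set.Iic n, {i : ℕ+ | i ≤ n ∧ L (i, j) = t}.encard)
    (⨆ i ∈ Set.Iic n, {j : ℕ+ | j ≤ n ∧ L (i, j) = t}.encard)

end StarProb

end

/-! Expanding `(1/n) E tr` of a word of length `k` gives `n^(-1-k/2)` times a sum over closed walks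
of length `k` on `Fin n`, where a starred letter traverses its directed edge backwards. The weight
of a walk is a mixed moment of `x` at its X-labels times a mixed moment of `y` at its Y-labels. This
weight is compared with the number of parses of the walk by a stack, in which a step is either
pushed or cancels the top entry by going back along its edge.

A step is fresh if both its labels are new and it ends at a new vertex. A step that is not fresh has
boundedly many possible ends, so the walks with fewer than `k/2` fresh steps from some starting
point number `O(n * n^((k-1)/2))` (`card_isDegenerate_le`) and are negligible. On every other walk
the weight equals the number of parses (`mul_eq_parseCount`). Indeed, if the weight is nonzero,
centring forces each label to recur, so at most `k/2` labels are new. Hence exactly `k/2` are, both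
labellings are pairings, and from each starting point their first occurrences agree. This data
determines a pairing (`label_eq_of_label_eq`), so the two pairings coincide, and injectivity makes
paired edges equal. The walk then goes round a tree and has one parse (`parseCount_eq_one`).
Conversely, a parse matches opposite traversals of an edge, which contribute `E|x|^2 = E|y|^2 = 1`.
So `E x^2` and `E y^2` play no role, and no further condition on the link functions is needed.

A push leaves the next vertex free and a pop prescribes it, so the total number of parses is exactly
`n^(1+k/2)` times the number of stack histories of the word (`sum_parseCount_closed`). The same
stack recursion computes the vacuum moments of `l true + star (l false)` on the full Fock space
(`IsFreeCreation.inner_word`), and this operator is circular (`IsFreeCreation.isCircular`). -/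

namespace StarProb

/-! ### Stack machines and ballot numbers -/

/-- The number of ways to process a word with a stack which initially contains `st` and finally is
empty, where each letter is either pushed on the stack or removes the opposite letter from its
top. -/
def stackCount : List Bool → List Bool → ℕ
  | [], st => if st = [] then 1 else 0
  | e :: l, [] => stackCount l [e]
  | e :: l, δ :: st => stackCount l (e :: δ :: st) + if δ = !e then stackCount l st else 0

/-- The number of nonnegative lattice paths of length `k` with steps `±1` from `0` to `m`. -/
def ballot : ℕ → ℕ → ℕ
  | 0, m => if m = 0 then 1 else 0
  | k + 1, 0 => ballot k 1
  | k + 1, m + 1 => ballot k m + ballot k (m + 2)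

theorem ballot_eq_zero_of_lt {k m : ℕ} (h : k < m) : ballot k m = 0 := by
  induction k generalizing m with
  | zero => simp [ballot]; omega
  | succ k ih =>
    obtain _ | m := m
    · omega
    · simp only [ballot]; rw [ih (by omega), ih (by omega)]

theorem ballot_self (m : ℕ) : ballot m m = 1 := by
  induction m with
  | zero => rfl
  | succ m ih => simp only [ballot]; rw [ih, ballot_eq_zero_of_lt (by omega)]

theorem ballot_eq_zero_of_odd {k m : ℕ} (h : Odd (k + m)) : ballot k m = 0 := by
  induction k generalizing m with
  | zero =>
    have : m ≠ 0 := by rintro rfl; simp at h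
    simp [ballot, this]
  | succ k ih =>
    obtain _ | m := m
    · exact ih h
    · simp only [ballot]
      have h1 : Odd (k + m) := by grind
      have h2 : Odd (k + (m + 2)) := by grind
      rw [ih h1, ih h2]

/-- The reflection principle: the paths to be discarded correspond to unrestricted paths with one
up-step or down-step exchanged, which are counted by the neighbouring binomial coefficient. -/
theorem ballot_add_choose (d m : ℕ) :
    ballot (m + 2 * (d + 1)) m + (m + 2 * (d + 1)).choose d
      = (m + 2 * (d + 1)).choose (d + 1) := by
  obtain ⟨N, hN⟩ : ∃ N, N = m + 2 * (d + 1) := ⟨_, rfl⟩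
  induction N generalizing d m with
  | zero => omega
  | succ N ih =>
    obtain _ | m := m
    · have hN' : N = 1 + 2 * d := by omega
      rw [← hN]
      simp only [ballot]
      obtain _ | d := d
      · subst hN'; rw [show 1 + 2 * 0 = 1 by rfl, ballot_self]; rfl
      · have := ih d 1 (by omega)
        rw [← hN'] at this
        have hs : N.choose (d + 1 + 1) = N.choose (d + 1) :=
          Nat.choose_symm_of_eq_add (by omega)
        rw [Nat.choose_succ_succ', Nat.choose_succ_succ' N (d + 1), hs]
        omega
    · rw [← hN]
      simp only [ballot]
      have h1 := ih d m (by omega)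
      rw [show m + 2 * (d + 1) = N by omega] at h1
      obtain _ | d := d
      · have : N = m + 2 := by omega
        subst this
        rw [ballot_self]
        have h0 : ∀ N : ℕ, N.choose 0 = 1 := Nat.choose_zero_right
        rw [Nat.choose_succ_succ']
        simp only [h0, zero_add] at *
        omega
      · have h2 := ih d (m + 2) (by omega)
        rw [show m + 2 + 2 * (d + 1) = N by omega] at h2
        rw [Nat.choose_succ_succ', Nat.choose_succ_succ' N (d + 1)]
        omega

theorem ballot_two_mul_zero (n : ℕ) : ballot (2 * n) 0 = catalan n := by
  obtain _ | d := n
  · simp [ballot]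
  · have h := ballot_add_choose d 0
    rw [zero_add] at h
    have h1 := succ_mul_catalan_eq_centralBinom (d + 1)
    rw [Nat.centralBinom_eq_two_mul_choose] at h1
    have h2 := Nat.choose_succ_right_eq (2 * (d + 1)) d
    rw [show 2 * (d + 1) - d = d + 2 by omega] at h2
    -- After multiplication by `d + 2`, the difference of neighbouring binomial coefficients
    -- collapses to the central one.
    have h3 : (d + 2) * ballot (2 * (d + 1)) 0 = (d + 2) * catalan (d + 1) := by
      zify at *
      linear_combination (d + 2) * h - h1 + h2
    exact Nat.eq_of_mul_eq_mul_left (by omega) h3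

/-! ### Free creation operators -/

section Fock

open Polynomial

variable {E : Type*} [NormedAddCommGroup E] [InnerProductSpace ℂ E]

/-- The vector functional `T ↦ ⟪Ω, T Ω⟫`. -/
noncomputable def vectorState (Ω : E) : (E →L[ℂ] E) →ₗ[ℂ] ℂ where
  toFun T := inner ℂ Ω (T Ω)
  map_add' _ _ := inner_add_right _ _ _
  map_smul' _ _ := inner_smul_right _ _ _

theorem vectorState_apply (Ω : E) (T : E →L[ℂ] E) : vectorState Ω T = inner ℂ Ω (T Ω) := rfl

variable [CompleteSpace E]

theorem inner_star_apply (T : E →L[ℂ] E) (u v : E) : inner ℂ (star T u) v = inner ℂ u (T v) :=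
  ContinuousLinearMap.adjoint_inner_left T v u

theorem isState_vectorState {Ω : E} (h : inner ℂ Ω Ω = (1 : ℂ)) : IsState (vectorState Ω) where
  map_one := h
  nonneg T := by
    rw [vectorState_apply, mul_apply_eq_comp, ← inner_star_apply, star_star]
    rw [inner_self_eq_norm_sq_to_K]
    norm_cast
    exact Complex.zero_le_real.2 (sq_nonneg ‖T Ω‖)

/-- Creation operators with orthonormal directions, and a vacuum vector `Ω`. -/
structure IsFreeCreation {ι : Type*} [DecidableEq ι] (Ω : E) (l : ι → E →L[ℂ] E) : Prop where
  inner_vacuum : inner ℂ Ω Ω = (1 : ℂ)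
  star_mul : ∀ i j, star (l i) * l j = if i = j then 1 else 0
  star_vacuum : ∀ i, star (l i) Ω = 0

variable {ι : Type*} [DecidableEq ι] {Ω : E} {l : ι → E →L[ℂ] E}

namespace IsFreeCreation

theorem star_apply (h : IsFreeCreation Ω l) (i j : ι) (v : E) :
    star (l i) (l j v) = if i = j then v else 0 := by
  rw [← mul_apply_eq_comp, h.star_mul]
  split_ifs <;> simp

theorem _root_.Polynomial.aeval_eq_mul_divX_add {A : Type*} [Ring A] [Algebra ℂ A] (a : A)
    (p : ℂ[X]) : aeval a p = a * aeval a p.divX + p.coeff 0 • 1 := by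
  conv_lhs => rw [← X_mul_divX_add p]
  rw [map_add, map_mul, aeval_X, aeval_C, Algebra.algebraMap_eq_smul_one]

/-- Multiplication by `l + l*` in terms of polynomials in `l`, on vectors killed by `l*`. -/
theorem add_star_apply_aeval (h : IsFreeCreation Ω l) (i : ι) (p : ℂ[X]) {v : E}
    (hv : star (l i) v = 0) :
    (l i + star (l i)) (aeval (l i) p v) = aeval (l i) (X * p + p.divX) v := by
  have h1 : star (l i) (aeval (l i) p v) = aeval (l i) p.divX v := by
    rw [aeval_eq_mul_divX_add]
    simp [h.star_apply, hv]
  simp [h1]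

/-- Normal ordering: because `star (l i) * l i = 1`, annihilators can be moved to the right until
they vanish on `v`, and only powers of `l i` remain. -/
theorem exists_aeval_of_mem_adjoin (h : IsFreeCreation Ω l) (i : ι) {a : E →L[ℂ] E}
    (ha : a ∈ Algebra.adjoin ℂ {l i + star (l i)}) :
    ∃ p : ℂ[X], ∀ v, star (l i) v = 0 → a v = aeval (l i) p v := by
  rw [Algebra.adjoin_singleton_eq_range_aeval] at ha
  obtain ⟨q, rfl⟩ := ha
  induction q using Polynomial.induction_on' with
  | add q₁ q₂ h₁ h₂ =>
    obtain ⟨p₁, hp₁⟩ := h₁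
    obtain ⟨p₂, hp₂⟩ := h₂
    refine ⟨p₁ + p₂, fun v hv => ?_⟩
    have e₁ := hp₁ v hv
    have e₂ := hp₂ v hv
    simp only [AlgHom.toRingHom_eq_coe, RingHom.coe_coe] at e₁ e₂ ⊢
    simp [e₁, e₂]
  | monomial n c =>
    suffices ∃ p : ℂ[X], ∀ v, star (l i) v = 0 →
        ((l i + star (l i)) ^ n) v = aeval (l i) p v by
      obtain ⟨p, hp⟩ := this
      refine ⟨C c * p, fun v hv => ?_⟩
      simp [aeval_monomial, hp v hv, Algebra.algebraMap_eq_smul_one]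
    induction n with
    | zero => exact ⟨1, fun v _ => by simp⟩
    | succ n ih =>
      obtain ⟨p, hp⟩ := ih
      refine ⟨X * p + p.divX, fun v hv => ?_⟩
      rw [pow_succ', mul_apply_eq_comp, hp v hv, h.add_star_apply_aeval i p hv]

theorem inner_vacuum_apply (h : IsFreeCreation Ω l) (i : ι) (v : E) :
    inner ℂ Ω (l i v) = 0 := by
  rw [← inner_star_apply, h.star_vacuum, inner_zero_left]

theorem inner_vacuum_aeval (h : IsFreeCreation Ω l) (i : ι) (p : ℂ[X]) :
    inner ℂ Ω (aeval (l i) p Ω) = p.coeff 0 := by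
  rw [aeval_eq_mul_divX_add, add_apply, inner_add_right, mul_apply_eq_comp, h.inner_vacuum_apply,
    smul_apply, inner_smul_right, one_apply_eq_self, h.inner_vacuum, zero_add,
    mul_one]

/-- Creation is an up-step and annihilation a down-step, so the coefficient of `l ^ m` in the `k`-th
power applied to the vacuum counts nonnegative paths from `0` to `m`. The vacuum expectation selects
`m = 0`. -/
theorem isSemicircular (h : IsFreeCreation Ω l) (i : ι) :
    IsSemicircular (vectorState Ω) (l i + star (l i)) where
  isSelfAdjoint := by simp [IsSelfAdjoint, add_comm]
  moment k := by
    have key : ∃ p : ℂ[X], (∀ m, p.coeff m = ballot k m) ∧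
        ((l i + star (l i)) ^ k) Ω = aeval (l i) p Ω := by
      induction k with
      | zero => exact ⟨1, fun m => by simp [ballot, coeff_one], by simp⟩
      | succ k ih =>
        obtain ⟨p, hp, hp'⟩ := ih
        refine ⟨X * p + p.divX, fun m => ?_, ?_⟩
        · obtain _ | m := m
          · simp [hp, ballot]
          · simp [hp, ballot]
        · rw [pow_succ', mul_apply_eq_comp, hp',
            h.add_star_apply_aeval i p (h.star_vacuum i)]
    obtain ⟨p, hp, hp'⟩ := key
    rw [vectorState_apply, hp', h.inner_vacuum_aeval, hp]
    split_ifs with hk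
    · obtain ⟨n, rfl⟩ := hk
      rw [← two_mul, ballot_two_mul_zero, Nat.mul_div_cancel_left _ two_pos]
    · rw [ballot_eq_zero_of_odd (by simpa using hk), Nat.cast_zero]

/-- Applied to the vacuum from right to left, an alternating product of centred elements always
lands in the range of the creation operator of its leftmost index, and this range is orthogonal to
the vacuum. -/
theorem freeElements (h : IsFreeCreation Ω l) :
    FreeElements (vectorState Ω) fun i => l i + star (l i) := by
  intro k hk i a ha h0 hne
  have key : ∀ (k : ℕ) (i : Fin (k + 1) → ι) (a : Fin (k + 1) → E →L[ℂ] E),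
      (∀ j, a j ∈ Algebra.adjoin ℂ {l (i j) + star (l (i j))}) →
      (∀ j, vectorState Ω (a j) = 0) →
      (∀ j j' : Fin (k + 1), (j : ℕ) + 1 = j' → i j ≠ i j') →
      ∃ v, (List.ofFn a).prod Ω = l (i 0) v := by
    intro k
    induction k with
    | zero =>
      intro i a ha h0 _
      obtain ⟨p, hp⟩ := h.exists_aeval_of_mem_adjoin (i 0) (ha 0)
      -- Centring is exactly the vanishing of the constant term, so a factor `l (i 0)` splits off.
      have hc : p.coeff 0 = 0 := by
        rw [← h.inner_vacuum_aeval (i 0), ← hp _ (h.star_vacuum _)]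
        exact h0 0
      refine ⟨aeval (l (i 0)) p.divX Ω, ?_⟩
      have hq : aeval (l (i 0)) p = l (i 0) * aeval (l (i 0)) p.divX := by
        rw [aeval_eq_mul_divX_add, hc, zero_smul, add_zero]
      simp [hp _ (h.star_vacuum _), hq]
    | succ k ih =>
      intro i a ha h0 hne
      obtain ⟨v, hv⟩ := ih (fun j => i j.succ) (fun j => a j.succ) (fun j => ha j.succ)
        (fun j => h0 j.succ) (fun j j' hj => hne j.succ j'.succ (by simp [hj]))
      -- Neighbouring indices differ, so the vector built so far is killed by the next annihilator
      -- and normal ordering applies again.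
      have hkill : star (l (i 0)) (l (i (Fin.succ 0)) v) = 0 := by
        rw [h.star_apply, if_neg (hne 0 (Fin.succ 0) (by simp))]
      obtain ⟨p, hp⟩ := h.exists_aeval_of_mem_adjoin (i 0) (ha 0)
      have hc : p.coeff 0 = 0 := by
        rw [← h.inner_vacuum_aeval (i 0), ← hp _ (h.star_vacuum _)]
        exact h0 0
      have hq : aeval (l (i 0)) p = l (i 0) * aeval (l (i 0)) p.divX := by
        rw [aeval_eq_mul_divX_add, hc, zero_smul, add_zero]
      refine ⟨aeval (l (i 0)) p.divX (l (i (Fin.succ 0)) v), ?_⟩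
      rw [List.ofFn_succ, List.prod_cons, mul_apply_eq_comp, hv, hp _ hkill, hq]
      rfl
  obtain ⟨k, rfl⟩ : ∃ k', k = k' + 1 := ⟨k - 1, by omega⟩
  obtain ⟨v, hv⟩ := key k i a ha h0 hne
  rw [vectorState_apply, hv, h.inner_vacuum_apply]

/-- The vacuum expectation of a word in `c = l true + (l false)*` and `c*`. -/
theorem inner_word {l : Bool → E →L[ℂ] E} (h : IsFreeCreation Ω l) (w st : List Bool) :
    inner ℂ ((st.map l).prod Ω)
      ((w.map fun e => if e then star (l true + star (l false))
        else l true + star (l false)).prod Ω) = (stackCount w st : ℂ) := by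
  induction w generalizing st with
  | nil =>
    obtain _ | ⟨δ, st⟩ := st
    · have := h.inner_vacuum
      simpa [stackCount] using this
    · have := h.inner_vacuum_apply δ ((st.map l).prod Ω)
      rw [← inner_conj_symm, map_eq_zero] at this
      simpa [stackCount] using this
  | cons e w ih =>
    rw [List.map_cons, List.prod_cons, mul_apply_eq_comp]
    -- Moved to the left of the inner product, the letter acts on the stack vector: `l e` pushes
    -- `e`, and `star (l !e)` pops `!e`.
    have hstar : star (if e then star (l true + star (l false)) else l true + star (l false))
        = l e + star (l !e) := by
      cases e <;> simp [add_comm]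
    rw [← inner_star_apply, hstar, add_apply, inner_add_left]
    have h1 := ih (e :: st)
    rw [List.map_cons, List.prod_cons, mul_apply_eq_comp] at h1
    rw [h1]
    obtain _ | ⟨δ, st⟩ := st
    · simp [stackCount, h.star_vacuum]
    · rw [List.map_cons, List.prod_cons, mul_apply_eq_comp, h.star_apply]
      simp only [stackCount, Nat.cast_add]
      congr 1
      by_cases hd : δ = !e
      · rw [if_pos hd.symm, if_pos hd, ih]
      · rw [if_neg (Ne.symm hd), if_neg hd, inner_zero_left, Nat.cast_zero]

theorem isCircular {l : Bool → E →L[ℂ] E} (h : IsFreeCreation Ω l) :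
    IsCircular (vectorState Ω) (l true + star (l false)) := by
  have hs : (((Real.sqrt 2 : ℝ) : ℂ)⁻¹) * ((Real.sqrt 2 : ℝ) : ℂ)⁻¹ = 2⁻¹ := by
    rw [← mul_inv, ← Complex.ofReal_mul, Real.mul_self_sqrt (by norm_num)]
    norm_num
  set r : ℂ := ((Real.sqrt 2 : ℝ) : ℂ)⁻¹ with hr
  have hrs : star r = r := by
    rw [hr, star_inv₀]
    congr 1
    exact Complex.conj_ofReal _
  -- A unitary change of the two directions, chosen so that in `s 0 + I • s 1` the terms `star (l
  -- true)` and `l false` cancel.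
  let m : Fin 2 → E →L[ℂ] E := ![r • (l true + l false), (-Complex.I * r) • (l true - l false)]
  have hm : IsFreeCreation Ω m := by
    refine ⟨h.inner_vacuum, fun i j => ?_, fun i => ?_⟩
    · have hI : star Complex.I = -Complex.I := Complex.conj_I
      have e1 : r * r + r * r = 1 := by rw [hs]; norm_num
      have e2 : Complex.I * r * (Complex.I * r) + Complex.I * r * (Complex.I * r) = -1 := by
        linear_combination (r * r + r * r) * Complex.I_mul_I - e1
      fin_cases i <;> fin_cases j <;>
        simp [m, mul_add, add_mul, mul_sub, sub_mul, h.star_mul, smul_smul, hrs, hI,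
          ← add_smul, e1, e2]
    · fin_cases i <;> simp [m, h.star_vacuum]
  refine ⟨fun i => m i + star (m i), hm.isSemicircular, hm.freeElements, ?_⟩
  have hI : star Complex.I = -Complex.I := Complex.conj_I
  have e3 : Complex.I * (Complex.I * r) = -r := by
    linear_combination r * Complex.I_mul_I
  have e4 : r * r + r * r = 1 := by rw [hs]; norm_num
  simp only [m, Matrix.cons_val_zero, Matrix.cons_val_one, star_smul, star_add, star_sub, star_mul',
    star_neg, hrs, hI, smul_add, smul_sub, smul_smul, neg_mul, neg_neg, neg_smul, e3]
  match_scalars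
  all_goals first
    | linear_combination r * r * Complex.I_mul_I - e4
    | linear_combination -(r * r) * Complex.I_mul_I
    | linear_combination -e4
    | ring1

end IsFreeCreation

/-! ### The full Fock space over a two-dimensional space -/

/-- The annihilation operator `x ↦ (w ↦ x (δ :: w))` on `ℓ²` of words. -/
noncomputable def annihilation (δ : Bool) :
    lp (fun _ : List Bool => ℂ) 2 →L[ℂ] lp (fun _ : List Bool => ℂ) 2 :=
  have hinj : Function.Injective fun w : List Bool => δ :: w := List.cons_injective
  have hpos : (0 : ℝ) < (2 : ℝ≥0∞).toReal := by norm_num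
  LinearMap.mkContinuous
    { toFun := fun x => ⟨fun w => x (δ :: w),
        memℓp_gen (((lp.memℓp x).summable hpos).comp_injective hinj)⟩
      map_add' := fun _ _ => rfl
      map_smul' := fun _ _ => rfl } 1 fun x => by
    rw [one_mul]
    refine lp.norm_le_of_tsum_le hpos (norm_nonneg x) ?_
    rw [lp.norm_rpow_eq_tsum hpos]
    exact tsum_comp_le_tsum_of_inj ((lp.memℓp x).summable hpos)
      (fun w => by positivity) hinj

theorem annihilation_apply (δ : Bool) (x : lp (fun _ : List Bool => ℂ) 2) (w : List Bool) :
    annihilation δ x w = x (δ :: w) := rfl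

/-- The vacuum vector. -/
noncomputable def vacuum : lp (fun _ : List Bool => ℂ) 2 := lp.single 2 [] 1

theorem lp_apply_eq_inner (x : lp (fun _ : List Bool => ℂ) 2) (w : List Bool) :
    x w = inner ℂ (lp.single 2 w (1 : ℂ) : lp (fun _ : List Bool => ℂ) 2) x := by
  rw [lp.inner_single_left]; simp

theorem annihilation_single (δ δ' : Bool) (w : List Bool) :
    annihilation δ (lp.single 2 (δ' :: w) (1 : ℂ)) =
      if δ = δ' then lp.single 2 w (1 : ℂ) else 0 := by
  ext w'
  rw [annihilation_apply]
  by_cases h : δ = δ'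
  · subst h
    by_cases hw : w' = w
    · subst hw; simp
    · rw [if_pos rfl, lp.single_apply_ne _ _ _ hw, lp.single_apply_ne _ _ _ (by simpa using hw)]
  · rw [if_neg h, lp.single_apply_ne _ _ _ (by simp [h])]; rfl

theorem isFreeCreation_star_annihilation :
    IsFreeCreation vacuum fun δ => star (annihilation δ) where
  inner_vacuum := by simp [vacuum]
  star_mul δ δ' := by
    ext x w
    rw [star_star, mul_apply_eq_comp, annihilation_apply, lp_apply_eq_inner,
      ← inner_star_apply, star_star, annihilation_single]
    by_cases h : δ = δ'
    · rw [if_pos h.symm, if_pos h, ← lp_apply_eq_inner]; rfl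
    · rw [if_neg (Ne.symm h), if_neg h, inner_zero_left]; rfl
  star_vacuum δ := by
    ext w
    rw [star_star, annihilation_apply, vacuum, lp.single_apply_ne _ _ _ (by simp)]; rfl

end Fock

/-! ### Walks and their parses by a stack machine -/

section Walks

variable {V : Type*}

/-- The directed edge used by a step from `u` to `v`, which is traversed backwards if `e` holds. -/
def stepEdge (e : Bool) (u v : V) : V × V := if e then (v, u) else (u, v)

theorem stepEdge_not (e : Bool) (u v : V) : stepEdge (!e) u v = stepEdge e v u := by
  cases e <;> rfl

theorem mem_stepEdge {e : Bool} {u v : V} {a : V}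
    (h : (stepEdge e u v).1 = a ∨ (stepEdge e u v).2 = a) : u = a ∨ v = a := by
  cases e <;> simp only [stepEdge] at h <;> tauto

theorem stepEdge_left_mem (e : Bool) (u v : V) :
    (stepEdge e u v).1 = u ∨ (stepEdge e u v).2 = u := by
  cases e <;> simp [stepEdge]

/-- Two consecutive steps over one directed edge must be inverse to each other unless the edge is a
loop, which `p ≠ u` excludes. This is what forces opposite signs. -/
theorem eq_not_of_stepEdge_eq {δ e : Bool} {p u v : V} (hpu : p ≠ u)
    (h : stepEdge δ p u = stepEdge e u v) : δ = (!e) ∧ v = p := by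
  cases δ <;> cases e <;> simp only [stepEdge, Bool.false_eq_true, if_false, if_true,
    Prod.mk.injEq] at h ⊢ <;> simp_all

/-- The directed edge used at time `r` by the walk `i`. -/
def walkEdge (ε : ℕ → Bool) (i : ℕ → V) (r : ℕ) : V × V := stepEdge (ε r) (i r) (i (r + 1))

/-- The edges recorded on a stack: the entry `(δ, p)` stands for a step from `p` to the vertex of
the entry above it. -/
def stackEdges : V → List (Bool × V) → List (Bool × (V × V))
  | _, [] => []
  | u, (δ, p) :: st => (δ, stepEdge δ p u) :: stackEdges p st

/-- The vertex at the bottom of a stack. -/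
def stackBottom : V → List (Bool × V) → V
  | u, [] => u
  | _, (_, p) :: st => stackBottom p st

theorem stackBottom_mem (u : V) (st : List (Bool × V)) :
    stackBottom u st ∈ u :: st.map Prod.snd := by
  induction st generalizing u with
  | nil => simp [stackBottom]
  | cons x st ih => exact List.mem_cons_of_mem _ (ih x.2)

theorem mem_of_mem_stackEdges {u : V} {st : List (Bool × V)} {x : Bool × (V × V)}
    (hx : x ∈ stackEdges u st) {a : V} (ha : x.2.1 = a ∨ x.2.2 = a) :
    a ∈ u :: st.map Prod.snd := by
  induction st generalizing u with
  | nil => simp [stackEdges] at hx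
  | cons y st ih =>
    obtain ⟨δ, p⟩ := y
    simp only [stackEdges, List.mem_cons] at hx
    rcases hx with rfl | hx
    · rcases mem_stepEdge ha with rfl | rfl <;> simp
    · exact List.mem_cons_of_mem _ (ih hx)

variable [DecidableEq V]

/-- The number of ways to read the `m` steps of the walk `i` from time `r` on with a stack: a step
is either pushed on the stack, or it goes back along the edge on top of the stack, which is
removed. -/
def parseCount (ε : ℕ → Bool) (i : ℕ → V) : ℕ → ℕ → List (Bool × V) → ℕ
  | 0, _, st => if st = [] then 1 else 0
  | m + 1, r, [] => parseCount ε i m (r + 1) [(ε r, i r)]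
  | m + 1, r, (δ, p) :: st => parseCount ε i m (r + 1) ((ε r, i r) :: (δ, p) :: st) +
      if δ = (!ε r) ∧ i (r + 1) = p then parseCount ε i m (r + 1) st else 0

theorem parseCount_le (ε : ℕ → Bool) (i : ℕ → V) (m r : ℕ) (st : List (Bool × V)) :
    parseCount ε i m r st ≤ 2 ^ m := by
  induction m generalizing r st with
  | zero => simp only [parseCount]; split_ifs <;> simp
  | succ m ih =>
    have h2 : 2 ^ (m + 1) = 2 ^ m + 2 ^ m := by ring
    obtain _ | ⟨⟨δ, p⟩, st⟩ := st
    · have := ih (r + 1) [(ε r, i r)]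
      simp only [parseCount]
      omega
    · have h1 := ih (r + 1) ((ε r, i r) :: (δ, p) :: st)
      have h3 := ih (r + 1) st
      simp only [parseCount]
      split_ifs <;> omega

theorem parseCount_congr {ε ε' : ℕ → Bool} {i i' : ℕ → V} {m r r' : ℕ}
    (hε : ∀ s < m, ε (r + s) = ε' (r' + s)) (hi : ∀ s ≤ m, i (r + s) = i' (r' + s))
    (st : List (Bool × V)) : parseCount ε i m r st = parseCount ε' i' m r' st := by
  induction m generalizing r r' st with
  | zero => rfl
  | succ m ih =>
    have key := fun st => ih (r := r + 1) (r' := r' + 1) (st := st)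
      (fun s hs => by simpa [add_assoc, add_comm 1] using hε (s + 1) (by omega))
      (fun s hs => by simpa [add_assoc, add_comm 1] using hi (s + 1) (by omega))
    have e0 : ε r = ε' r' := hε 0 (by omega)
    have i0 : i r = i' r' := hi 0 (by omega)
    have i1 : i (r + 1) = i' (r' + 1) := hi 1 (by omega)
    obtain _ | ⟨⟨δ, p⟩, st⟩ := st
    · simp only [parseCount, key, e0, i0]
    · simp only [parseCount, key, e0, i0, i1]

/-- In a walk with a parse, each step is matched with a step which goes back along the same edge,
or with an edge of the stack. -/
theorem exists_match_of_parseCount_pos {ε : ℕ → Bool} {i : ℕ → V} {m r : ℕ}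
    {st : List (Bool × V)} (h : 0 < parseCount ε i m r st) :
    (∀ x ∈ stackEdges (i r) st, ∃ q, r ≤ q ∧ q < r + m ∧ ε q = (!x.1) ∧ walkEdge ε i q = x.2) ∧
    (∀ q, r ≤ q → q < r + m → (∃ q', r ≤ q' ∧ q' < r + m ∧ q' ≠ q ∧ ε q' = (!ε q) ∧
      walkEdge ε i q' = walkEdge ε i q) ∨ ((!ε q), walkEdge ε i q) ∈ stackEdges (i r) st) ∧
    i (r + m) = stackBottom (i r) st := by
  induction m generalizing r st with
  | zero =>
    have : st = [] := by
      by_contra hst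
      simp [parseCount, hst] at h
    subst this
    refine ⟨by simp [stackEdges], fun q h1 h2 => by omega, rfl⟩
  | succ m ih =>
    have push : 0 < parseCount ε i m (r + 1) ((ε r, i r) :: st) → _ := fun hp => by
      obtain ⟨h1, h2, h3⟩ := ih hp
      have goal : (∀ x ∈ stackEdges (i r) st, ∃ q, r ≤ q ∧ q < r + (m + 1) ∧ ε q = (!x.1) ∧
            walkEdge ε i q = x.2) ∧
          (∀ q, r ≤ q → q < r + (m + 1) → (∃ q', r ≤ q' ∧ q' < r + (m + 1) ∧ q' ≠ q ∧
            ε q' = (!ε q) ∧ walkEdge ε i q' = walkEdge ε i q) ∨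
            ((!ε q), walkEdge ε i q) ∈ stackEdges (i r) st) ∧
          i (r + (m + 1)) = stackBottom (i r) st := by
        refine ⟨fun x hx => ?_, fun q hq hq' => ?_, ?_⟩
        · obtain ⟨q, a, b, c⟩ := h1 x (List.mem_cons_of_mem _ hx)
          exact ⟨q, by omega, by omega, c⟩
        · rcases hq.eq_or_lt with rfl | hlt
          · obtain ⟨q, a, b, c, d⟩ := h1 (ε r, walkEdge ε i r) (List.mem_cons_self ..)
            exact Or.inl ⟨q, by omega, by omega, by omega, c, d⟩
          · rcases h2 q hlt (by omega) with ⟨q', a, b, c⟩ | hmem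
            · exact Or.inl ⟨q', by omega, by omega, c⟩
            · simp only [stackEdges, List.mem_cons] at hmem
              rcases hmem with heq | hmem
              · rw [Prod.mk.injEq] at heq
                refine Or.inl ⟨r, le_rfl, by omega, by omega, ?_, heq.2.symm⟩
                rw [← heq.1]
              · exact Or.inr hmem
        · rw [show r + (m + 1) = r + 1 + m by omega, h3]
          rfl
      exact goal
    obtain _ | ⟨⟨δ, p⟩, st⟩ := st
    · exact push h
    · simp only [parseCount] at h
      by_cases hp : 0 < parseCount ε i m (r + 1) ((ε r, i r) :: (δ, p) :: st)
      · exact push hp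
      · have hcond : δ = (!ε r) ∧ i (r + 1) = p := by
          by_contra hc
          rw [if_neg hc] at h
          omega
        rw [if_pos hcond] at h
        obtain ⟨rfl, rfl⟩ := hcond
        obtain ⟨h1, h2, h3⟩ := ih (r := r + 1) (st := st) (by omega)
        have htop : stepEdge (!ε r) (i (r + 1)) (i r) = walkEdge ε i r := stepEdge_not _ _ _
        refine ⟨fun x hx => ?_, fun q hq hq' => ?_, ?_⟩
        · simp only [stackEdges, List.mem_cons] at hx
          rcases hx with rfl | hx
          · exact ⟨r, le_rfl, by omega, by simp, htop.symm⟩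
          · obtain ⟨q, a, b, c⟩ := h1 x hx
            exact ⟨q, by omega, by omega, c⟩
        · rcases hq.eq_or_lt with rfl | hlt
          · refine Or.inr ?_
            rw [stackEdges, htop]
            exact List.mem_cons_self ..
          · rcases h2 q hlt (by omega) with ⟨q', a, b, c⟩ | hmem
            · exact Or.inl ⟨q', by omega, by omega, c⟩
            · exact Or.inr (List.mem_cons_of_mem _ hmem)
        · rw [show r + (m + 1) = r + 1 + m by omega, h3]
          rfl

/-- A closed walk which uses no edge three times, and which at each step uses an edge again or uses
a new edge to a new vertex, has exactly one parse. -/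
theorem parseCount_eq_one {ε : ℕ → Bool} {i : ℕ → V} {k : ℕ} (hclosed : i k = i 0)
    (hstep : ∀ r < k, (∃ s < r, walkEdge ε i s = walkEdge ε i r) ∨ ∀ s ≤ r, i (r + 1) ≠ i s)
    (hthree : ∀ r < k, ∀ s < r, ∀ q < k, walkEdge ε i s = walkEdge ε i r →
      walkEdge ε i q = walkEdge ε i r → q = r ∨ q = s) :
    parseCount ε i k 0 [] = 1 := by
  -- Invariant: the stack is a simple path from `i 0` to the current vertex, through visited
  -- vertices, and it contains every edge used exactly once so far.
  suffices H : ∀ m r st, r + m = k → (i r :: st.map Prod.snd).Nodup →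
      (∀ p ∈ st.map Prod.snd, ∃ s < r, i s = p) → stackBottom (i r) st = i 0 →
      (∀ s < r, (∀ s' < r, walkEdge ε i s' = walkEdge ε i s → s' = s) →
        ∃ δ, (δ, walkEdge ε i s) ∈ stackEdges (i r) st) → parseCount ε i m r st = 1 from
    H k 0 [] (by simp) (by simp) (by simp) rfl (by simp)
  intro m
  induction m with
  | zero =>
    intro r st hr hnd _ hb _
    obtain rfl : r = k := hr
    obtain _ | ⟨x, st⟩ := st
    · rfl
    -- A nonempty stack would be a simple path whose two ends are both `i 0`.
    · exfalso
      rw [← hclosed] at hb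
      rw [List.nodup_cons] at hnd
      refine hnd.1 ?_
      rw [← hb]
      exact stackBottom_mem x.2 st
  | succ m ih =>
    intro r st hr hnd hvis hb honce
    rcases hstep r (by omega) with ⟨s, hsr, hs⟩ | hnew
    · have hmem := honce s hsr fun s' hs' he => by
        rcases hthree r (by omega) s hsr s' (by omega) hs (he.trans hs) with h | h
        · omega
        · exact h
      obtain ⟨δ', hδ'⟩ := hmem
      obtain _ | ⟨⟨δ, p⟩, st⟩ := st
      · simp [stackEdges] at hδ'
      -- A pushed step needs a later partner, which would be a third use of the edge.
      have hpush : parseCount ε i m (r + 1) ((ε r, i r) :: (δ, p) :: st) = 0 := by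
        by_contra hne
        obtain ⟨q, a, b, c, d⟩ := (exists_match_of_parseCount_pos (Nat.pos_of_ne_zero hne)).1
          (ε r, walkEdge ε i r) (List.mem_cons_self ..)
        rcases hthree r (by omega) s hsr q (by omega) hs d with h | h <;> omega
      simp only [List.map_cons, List.nodup_cons] at hnd
      -- The path is simple, so only its top edge touches the current vertex.
      have htop : stepEdge δ p (i r) = walkEdge ε i r := by
        simp only [stackEdges, List.mem_cons] at hδ'
        rcases hδ' with h | h
        · rw [Prod.mk.injEq] at h
          rw [← h.2, hs]
        · exfalso
          have := mem_of_mem_stackEdges h (a := i r) (by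
            rw [hs]; exact stepEdge_left_mem _ _ _)
          exact hnd.1 this
      obtain ⟨rfl, hv⟩ := eq_not_of_stepEdge_eq
        (fun hp => hnd.1 (by rw [hp]; exact List.mem_cons_self ..)) htop
      simp only [parseCount]
      rw [hpush, if_pos (by simp [hv]), zero_add]
      refine ih (r + 1) st (by omega) ?_ ?_ ?_ ?_
      · rw [hv]; exact List.nodup_cons.2 hnd.2
      · intro p' hp'
        obtain ⟨s', h1, h2⟩ := hvis p' (List.mem_cons_of_mem _ hp')
        exact ⟨s', by omega, h2⟩
      · rw [hv]; exact hb
      · intro s' hs' hu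
        have hs'r : s' ≠ r := by
          rintro rfl
          have := hu s (by omega) hs
          omega
        obtain ⟨δ', hmem⟩ := honce s' (by omega) fun s'' h1 h2 => hu s'' (by omega) h2
        refine ⟨δ', ?_⟩
        simp only [stackEdges, List.mem_cons] at hmem
        rcases hmem with h | h
        · exfalso
          rw [Prod.mk.injEq] at h
          have := hu r (by omega) (htop.symm.trans h.2.symm)
          omega
        · rw [hv]; exact h
    · have hpush : parseCount ε i m (r + 1) ((ε r, i r) :: st) = 1 := by
        refine ih (r + 1) _ (by omega) ?_ ?_ hb ?_
        · rw [List.map_cons, List.nodup_cons]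
          refine ⟨fun hmem => ?_, hnd⟩
          rcases List.mem_cons.1 hmem with h | h
          · exact hnew r le_rfl h
          · obtain ⟨s, h1, h2⟩ := hvis _ h
            exact hnew s h1.le h2.symm
        · intro p hp
          rcases List.mem_cons.1 hp with rfl | h
          · exact ⟨r, by omega, rfl⟩
          · obtain ⟨s, h1, h2⟩ := hvis p h
            exact ⟨s, by omega, h2⟩
        · intro s hs hu
          rcases Nat.lt_succ_iff_lt_or_eq.1 hs with h | rfl
          · obtain ⟨δ, hδ⟩ := honce s h fun s' h1 h2 => hu s' (by omega) h2
            exact ⟨δ, List.mem_cons_of_mem _ hδ⟩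
          · exact ⟨ε s, List.mem_cons_self ..⟩
      obtain _ | ⟨⟨δ, p⟩, st⟩ := st
      · exact hpush
      · simp only [parseCount]
        -- A pop would lead to a vertex already visited.
        rw [hpush, if_neg]
        rintro ⟨-, hv⟩
        obtain ⟨s, h1, h2⟩ := hvis p (List.mem_cons_self ..)
        exact hnew s h1.le (hv.trans h2.symm)

/-- The infinite periodic sequence with the terms of `p`. -/
def finSeq {m : ℕ} {α : Type*} (p : Fin (m + 1) → α) (r : ℕ) : α := p (Fin.ofNat (m + 1) r)

theorem finSeq_of_lt {m : ℕ} {α : Type*} (p : Fin (m + 1) → α) {r : ℕ} (h : r < m + 1) :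
    finSeq p r = p ⟨r, h⟩ := by
  unfold finSeq
  congr 1
  ext
  simp [Nat.mod_eq_of_lt h]

/-- Power counting: emptying the stack in `m` steps takes `(m - st.length) / 2` pushes, each with a
free next vertex, while the next vertex of a pop is prescribed. Square roots avoid a case
distinction on parity. -/
theorem sum_parseCount [Fintype V] (m : ℕ) (ε : ℕ → Bool) (u : V) (st : List (Bool × V)) :
    Real.sqrt (Fintype.card V) ^ st.length *
      ∑ p : Fin m → V, (parseCount ε (finSeq (Fin.cons u p : Fin (m + 1) → V)) m 0 st : ℝ) =
    stackCount (List.ofFn fun r : Fin m => ε r) (st.map Prod.fst) *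
      Real.sqrt (Fintype.card V) ^ m := by
  induction m generalizing ε u st with
  | zero =>
    obtain _ | ⟨x, st⟩ := st <;> simp [parseCount, stackCount]
  | succ m ih =>
    set S := Real.sqrt (Fintype.card V) with hS
    have hSS : S * S = Fintype.card V := Real.mul_self_sqrt (by positivity)
    have hshift : ∀ (v : V) (q : Fin m → V) (st : List (Bool × V)),
        parseCount ε (finSeq (Fin.cons u (Fin.cons v q : Fin (m + 1) → V) : Fin (m + 2) → V)) m 1 st
        = parseCount (fun r => ε (r + 1)) (finSeq (Fin.cons v q : Fin (m + 1) → V)) m 0 st := by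
      intro v q st
      refine parseCount_congr (fun s _ => by simp [add_comm]) (fun s hs => ?_) st
      rw [zero_add, finSeq_of_lt _ (show 1 + s < m + 2 by omega),
        finSeq_of_lt _ (show s < m + 1 by omega)]
      have : (⟨1 + s, by omega⟩ : Fin (m + 2)) = Fin.succ ⟨s, by omega⟩ := by
        ext; simp [add_comm]
      rw [this, Fin.cons_succ]
    have h0 : ∀ p : Fin (m + 1) → V, finSeq (Fin.cons u p : Fin (m + 2) → V) 0 = u := fun p => by
      rw [finSeq_of_lt _ (by omega)]; rfl
    have h1 : ∀ p : Fin (m + 1) → V, finSeq (Fin.cons u p : Fin (m + 2) → V) 1 = p 0 := fun p => by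
      rw [finSeq_of_lt _ (by omega)]; rfl
    have hpush : ∀ st : List (Bool × V), S ^ st.length * ∑ p : Fin (m + 1) → V,
        (parseCount ε (finSeq (Fin.cons u p : Fin (m + 2) → V)) m 1 ((ε 0, u) :: st) : ℝ) =
        stackCount (List.ofFn fun r : Fin m => ε (r + 1)) (ε 0 :: st.map Prod.fst) * S ^ (m + 1) :=
      fun st => by
      rw [← (Fin.consEquiv fun _ : Fin (m + 1) => V).sum_comp, Fintype.sum_prod_type]
      simp only [Fin.consEquiv, Equiv.coe_fn_mk, hshift]
      have hterm : ∀ v : V, S * (S ^ st.length * ∑ q : Fin m → V,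
          (parseCount (fun r => ε (r + 1)) (finSeq (Fin.cons v q : Fin (m + 1) → V)) m 0
            ((ε 0, u) :: st) : ℝ)) =
          stackCount (List.ofFn fun r : Fin m => ε (r + 1)) (ε 0 :: st.map Prod.fst)
            * S ^ m := fun v => by
        rw [← mul_assoc, ← pow_succ']
        exact ih (fun r => ε (r + 1)) v ((ε 0, u) :: st)
      rcases eq_or_ne S 0 with h | h
      · have : IsEmpty V := by
          rw [h, zero_mul] at hSS
          exact Fintype.card_eq_zero_iff.1 (by exact_mod_cast hSS.symm)
        simp [h]
      · refine mul_left_cancel₀ h ?_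
        rw [Finset.mul_sum, Finset.mul_sum, Finset.sum_congr rfl fun v _ => hterm v]
        simp only [Finset.sum_const, Finset.card_univ, nsmul_eq_mul, ← hSS]
        ring
    have hpop : ∀ (δ : Bool) (p' : V) (st : List (Bool × V)), S ^ (st.length + 1) *
        ∑ p : Fin (m + 1) → V, ((if δ = (!ε 0) ∧ p 0 = p' then
          parseCount ε (finSeq (Fin.cons u p : Fin (m + 2) → V)) m 1 st else 0 : ℕ) : ℝ) =
        ((if δ = (!ε 0) then
          stackCount (List.ofFn fun r : Fin m => ε (r + 1)) (st.map Prod.fst) else 0 : ℕ) : ℝ) *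
          S ^ (m + 1) := fun δ p' st => by
      rw [← (Fin.consEquiv fun _ : Fin (m + 1) => V).sum_comp, Fintype.sum_prod_type]
      simp only [Fin.consEquiv, Equiv.coe_fn_mk, hshift, Fin.cons_zero]
      by_cases hδ : δ = !ε 0
      · simp only [hδ, true_and, if_true]
        -- The pop prescribes the next vertex, so the sum over it has one term.
        rw [Fintype.sum_eq_single p' (fun v hv => by simp [hv])]
        simp only [if_true]
        have := ih (fun r => ε (r + 1)) p' st
        rw [pow_succ', mul_assoc, this]
        ring
      · simp [hδ]
    rw [List.ofFn_succ]
    obtain _ | ⟨⟨δ, p'⟩, st⟩ := st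
    · have := hpush []
      simpa [parseCount, stackCount, h0] using this
    · have a := hpush ((δ, p') :: st)
      have b := hpop δ p' st
      simp only [parseCount, stackCount, h0, h1, List.map_cons, List.length_cons, Nat.cast_add,
        Finset.sum_add_distrib, mul_add, add_mul, zero_add, Fin.val_succ, Fin.val_zero] at a b ⊢
      rw [a, b]

end Walks

/-! ### Labellings of a cyclically ordered set -/

section Cyclic

variable {k : ℕ} [NeZero k] {I J : Type*}

/-- In the order of `ZMod k` which starts at `t`, the label `a q` occurs at `q` for the first
time. -/
def IsNewLabel (a : ZMod k → I) (t q : ZMod k) : Prop :=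
  ∀ s, (s - t).val < (q - t).val → a s ≠ a q

/-- The place of `q` in the cyclic order starting just after `s`, where `s` comes last, in a form
linear in the representatives. -/
theorem val_sub_add_one (q s : ZMod k) :
    (q.val ≤ s.val → (q - (s + 1)).val = q.val + (k - 1 - s.val)) ∧
      (s.val < q.val → (q - (s + 1)).val = q.val - (s.val + 1)) := by
  have hs := ZMod.val_lt s
  have hq := ZMod.val_lt q
  constructor
  · intro h
    have : q - (s + 1) = ((q.val + (k - 1 - s.val) : ℕ) : ZMod k) := by
      rw [Nat.sub_sub, Nat.cast_add, Nat.cast_sub (by omega)]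
      simp
      ring
    rw [this, ZMod.val_natCast, Nat.mod_eq_of_lt (by omega)]
  · intro h
    have : q - (s + 1) = ((q.val - (s.val + 1) : ℕ) : ZMod k) := by
      rw [Nat.cast_sub (by omega)]
      simp
    rw [this, ZMod.val_natCast, Nat.mod_eq_of_lt (by omega)]

open Classical in
/-- The positions at which new labels occur. -/
noncomputable def newLabels (a : ZMod k → I) (t : ZMod k) : Finset (ZMod k) :=
  Finset.univ.filter fun q => IsNewLabel a t q

theorem mem_newLabels {a : ZMod k → I} {t q : ZMod k} :
    q ∈ newLabels a t ↔ IsNewLabel a t q := by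
  classical
  simp [newLabels]

open Classical in
theorem card_newLabels_le (a : ZMod k → I) (t : ZMod k) :
    (newLabels a t).card ≤ (Finset.univ.image a).card := by
  refine Finset.card_le_card_of_injOn a (fun q _ => by simp) fun q hq q' hq' h => ?_
  have h1 := mem_newLabels.1 hq
  have h2 := mem_newLabels.1 hq'
  rcases lt_trichotomy (q - t).val (q' - t).val with hlt | heq | hlt
  · exact absurd h (h2 q hlt)
  · exact sub_left_injective (ZMod.val_injective k heq)
  · exact absurd h.symm (h1 q' hlt)

open Classical in
theorem two_le_card_fiber {a : ZMod k → I} (ha : ∀ r, ∃ s, s ≠ r ∧ a s = a r) :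
    ∀ α ∈ Finset.univ.image a, 2 ≤ (Finset.univ.filter fun r => a r = α).card := by
  intro α hα
  obtain ⟨r, -, rfl⟩ := Finset.mem_image.1 hα
  obtain ⟨s, hs, hsa⟩ := ha r
  exact Finset.one_lt_card.2 ⟨s, by simp [hsa], r, by simp, hs⟩

open Classical in
theorem card_eq_sum_card_fiber (a : ZMod k → I) :
    k = ∑ α ∈ Finset.univ.image a, (Finset.univ.filter fun r => a r = α).card := by
  rw [← Finset.card_eq_sum_card_image a Finset.univ, Finset.card_univ, ZMod.card]

theorem two_mul_card_newLabels_le {a : ZMod k → I} (ha : ∀ r, ∃ s, s ≠ r ∧ a s = a r)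
    (t : ZMod k) : 2 * (newLabels a t).card ≤ k := by
  classical
  calc 2 * (newLabels a t).card ≤ (Finset.univ.image a).card * 2 := by
        have := card_newLabels_le a t; omega
    _ ≤ ∑ α ∈ Finset.univ.image a, (Finset.univ.filter fun r => a r = α).card :=
        Finset.card_nsmul_le_sum _ _ _ (two_le_card_fiber ha)
    _ = k := (card_eq_sum_card_fiber a).symm

/-- If at least half of the positions have new labels, and no label occurs only once, then all
labels occur twice. -/
theorem eq_or_eq_of_le_card_newLabels {a : ZMod k → I} (ha : ∀ r, ∃ s, s ≠ r ∧ a s = a r)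
    {t : ZMod k} (h : k ≤ 2 * (newLabels a t).card) {r s q : ZMod k} (hsr : s ≠ r)
    (hs : a s = a r) (hq : a q = a r) : q = r ∨ q = s := by
  classical
  have hsum : ∑ α ∈ Finset.univ.image a, 2 =
      ∑ α ∈ Finset.univ.image a, (Finset.univ.filter fun r => a r = α).card := by
    refine le_antisymm (Finset.sum_le_sum (two_le_card_fiber ha)) ?_
    rw [← card_eq_sum_card_fiber, Finset.sum_const, smul_eq_mul]
    have := card_newLabels_le a t
    omega
  have hfib := (Finset.sum_eq_sum_iff_of_le (two_le_card_fiber ha)).1 hsum (a r) (by simp)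
  by_contra hne
  push Not at hne
  have : 2 < (Finset.univ.filter fun r' => a r' = a r).card :=
    Finset.two_lt_card.2 ⟨r, by simp, s, by simp [hs], q, by simp [hq], hsr.symm, hne.1.symm,
      hne.2.symm⟩
  omega

omit [NeZero k] in
theorem isNewLabel_of_pair {a : ZMod k → I} {t r s : ZMod k}
    (hpair : ∀ q, a q = a r → q = r ∨ q = s) (h : (r - t).val ≤ (s - t).val) :
    IsNewLabel a t r := by
  intro q hq he
  rcases hpair q he with rfl | rfl
  · exact lt_irrefl _ hq
  · omega

/-- If, for each starting point, at least half of the positions have new labels for both `a` and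
`b`, then `a` and `b` define the same pairing. -/
theorem label_eq_of_label_eq {a : ZMod k → I} {b : ZMod k → J}
    (ha : ∀ r, ∃ s, s ≠ r ∧ a s = a r) (hb : ∀ r, ∃ s, s ≠ r ∧ b s = b r)
    (h : ∀ t, ∃ S : Finset (ZMod k), k ≤ 2 * S.card ∧ S ⊆ newLabels a t ∧ S ⊆ newLabels b t)
    {r s : ZMod k} (hsr : s ≠ r) (hs : a s = a r) : b s = b r := by
  -- Both sets have at most `k / 2` elements and contain `S`, which has at least `k / 2`.
  have hnew : ∀ t, newLabels a t = newLabels b t := fun t => by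
    obtain ⟨S, hS, hSa, hSb⟩ := h t
    have h1 := two_mul_card_newLabels_le ha t
    have h2 := two_mul_card_newLabels_le hb t
    rw [← Finset.eq_of_subset_of_card_le hSa (by omega),
      ← Finset.eq_of_subset_of_card_le hSb (by omega)]
  obtain ⟨S, hS, hSa, hSb⟩ := h 0
  have hSa' := Finset.card_le_card hSa
  have hSb' := Finset.card_le_card hSb
  have hpa : ∀ q, a q = a r → q = r ∨ q = s := fun q hq =>
    eq_or_eq_of_le_card_newLabels ha (t := 0) (by omega) hsr hs hq
  obtain ⟨t, htr, ht⟩ := hb r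
  have hpb : ∀ q, b q = b r → q = r ∨ q = t := fun q hq =>
    eq_or_eq_of_le_card_newLabels hb (t := 0) (by omega) htr ht hq
  by_cases hst : s = t
  · rw [hst, ht]
  exfalso
  have vr := ZMod.val_lt r
  have vs := ZMod.val_lt s
  have vt := ZMod.val_lt t
  have nrs : r.val ≠ s.val := fun e => hsr (ZMod.val_injective k e).symm
  have nrt : r.val ≠ t.val := fun e => htr (ZMod.val_injective k e).symm
  have nst : s.val ≠ t.val := fun e => hst (ZMod.val_injective k e)
  -- Starting just after `s`, the position `r` is new for `a`, hence for `b`, so `r` precedes `t`.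
  -- Starting just after `t`, likewise `r` precedes `s`. These are opposite cyclic orders of `r`,
  -- `s`, `t`. A single starting point would not suffice: the pairings `abab` and `abba` have the
  -- same first occurrences.
  have h1 : IsNewLabel a (s + 1) r := isNewLabel_of_pair hpa (by
    have := val_sub_add_one r s; have := val_sub_add_one s s; omega)
  have h2 : IsNewLabel b (t + 1) r := isNewLabel_of_pair hpb (by
    have := val_sub_add_one r t; have := val_sub_add_one t t; omega)
  rw [← mem_newLabels, hnew, mem_newLabels] at h1
  rw [← mem_newLabels, ← hnew, mem_newLabels] at h2
  have h1' : ¬ (t - (s + 1)).val < (r - (s + 1)).val := fun hlt => h1 t hlt ht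
  have h2' : ¬ (s - (t + 1)).val < (r - (t + 1)).val := fun hlt => h2 s hlt hs
  have e1 := val_sub_add_one r s
  have e2 := val_sub_add_one t s
  have e3 := val_sub_add_one r t
  have e4 := val_sub_add_one s t
  omega

end Cyclic

/-! ### Counting degenerate walks -/

section Counting

variable {V : Type*} [Fintype V]

/-- A sum over walks of a product of weights, where the weight of a step depends on the walk up to
this step, is bounded by bounding the sum over the end of each step. -/
theorem sum_prod_le_of_sum_update_le (m : ℕ) (w : ℕ → (ℕ → V) → ℝ) (hw : ∀ r i, 0 ≤ w r i)
    (hdep : ∀ r i j, (∀ s ≤ r + 1, i s = j s) → w r i = w r j) {D : ℝ}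
    (hD : ∀ r < m, ∀ i, ∑ v, w r (Function.update i (r + 1) v) ≤ D) :
    ∑ p : Fin (m + 1) → V, ∏ r ∈ Finset.range m, w r (finSeq p) ≤ Fintype.card V * D ^ m := by
  classical
  induction m with
  | zero => simp
  | succ m ih =>
    have hle := ih fun r hr => hD r (by omega)
    rcases isEmpty_or_nonempty V with hV | ⟨⟨v₀⟩⟩
    · simp
    have hD0 : 0 ≤ D := (Finset.sum_nonneg fun v _ => hw _ _).trans (hD 0 (by omega) fun _ => v₀)
    rw [← (Fin.snocEquiv fun _ : Fin (m + 1 + 1) => V).sum_comp, Fintype.sum_prod_type,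
      Finset.sum_comm]
    have hagree : ∀ (q : Fin (m + 1) → V) (v : V), ∀ s ≤ m + 1,
        finSeq (Fin.snoc q v : Fin (m + 2) → V) s = Function.update (finSeq q) (m + 1) v s := by
      intro q v s hs
      rw [finSeq_of_lt _ (show s < m + 2 by omega)]
      rcases hs.eq_or_lt with rfl | hlt
      · rw [Function.update_self]
        exact Fin.snoc_last (α := fun _ => V) v q
      · rw [Function.update_of_ne hlt.ne, finSeq_of_lt _ hlt]
        exact Fin.snoc_castSucc (α := fun _ => V) v q ⟨s, hlt⟩
    have hterm : ∀ q : Fin (m + 1) → V,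
        ∑ v, ∏ r ∈ Finset.range (m + 1), w r (finSeq (Fin.snoc q v : Fin (m + 2) → V)) ≤
          (∏ r ∈ Finset.range m, w r (finSeq q)) * D := by
      intro q
      have : ∀ v : V, ∏ r ∈ Finset.range (m + 1), w r (finSeq (Fin.snoc q v : Fin (m + 2) → V)) =
          (∏ r ∈ Finset.range m, w r (finSeq q)) * w m (Function.update (finSeq q) (m + 1) v) := by
        intro v
        rw [Finset.prod_range_succ, hdep m _ _ (hagree q v)]
        congr 1
        refine Finset.prod_congr rfl fun r hr => hdep r _ _ fun s hs => ?_
        have := Finset.mem_range.1 hr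
        rw [hagree q v s (by omega), Function.update_of_ne (by omega)]
      rw [Finset.sum_congr rfl fun v _ => this v, ← Finset.mul_sum]
      exact mul_le_mul_of_nonneg_left (hD m (by omega) _) (Finset.prod_nonneg fun r _ => hw _ _)
    calc _ ≤ ∑ q : Fin (m + 1) → V, (∏ r ∈ Finset.range m, w r (finSeq q)) * D :=
          Finset.sum_le_sum fun q _ => hterm q
      _ ≤ _ := by
          rw [← Finset.sum_mul, pow_succ, ← mul_assoc]
          exact mul_le_mul_of_nonneg_right hle hD0

variable {I J : Type*} (fX : V × V → I) (fY : V × V → J)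

/-- A step with a new label of both kinds, which ends at a new vertex. -/
def IsFreshStep (ε : ℕ → Bool) (i : ℕ → V) (r : ℕ) : Prop :=
  (∀ s < r, fX (walkEdge ε i s) ≠ fX (walkEdge ε i r)) ∧
  (∀ s < r, fY (walkEdge ε i s) ≠ fY (walkEdge ε i r)) ∧ ∀ s ≤ r, i (r + 1) ≠ i s

omit [Fintype V] in
theorem isFreshStep_congr {ε : ℕ → Bool} {i j : ℕ → V} {r : ℕ} (h : ∀ s ≤ r + 1, i s = j s) :
    IsFreshStep fX fY ε i r ↔ IsFreshStep fX fY ε j r := by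
  have he : ∀ s ≤ r, walkEdge ε i s = walkEdge ε j s := fun s hs => by
    rw [walkEdge, walkEdge, h s (by omega), h (s + 1) (by omega)]
  unfold IsFreshStep
  rw [he r le_rfl, h (r + 1) le_rfl]
  refine and_congr (forall₂_congr fun s hs => ?_) (and_congr (forall₂_congr fun s hs => ?_)
    (forall₂_congr fun s hs => ?_))
  · rw [he s hs.le]
  · rw [he s hs.le]
  · rw [h s (by omega)]

open Classical in
/-- The times of the fresh steps among the first `k` steps. -/
noncomputable def freshSteps (ε : ℕ → Bool) (i : ℕ → V) (k : ℕ) : Finset ℕ :=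
  (Finset.range k).filter (IsFreshStep fX fY ε i)

/-- A value of the label is taken at most `C` times among the edges starting or ending at a given
vertex. -/
def BoundedMultiplicity {I : Type*} (f : V × V → I) (C : ℕ) : Prop :=
  ∀ (e : Bool) (u : V) (t : I), {v | f (stepEdge e u v) = t}.ncard ≤ C

-- The end of a step that is not fresh repeats one of `r` earlier labels of either kind or is one of
-- the `r + 1` vertices already visited.
open Classical in
theorem card_not_isFreshStep_le {CX CY : ℕ} (hX : BoundedMultiplicity fX CX)
    (hY : BoundedMultiplicity fY CY) {m r : ℕ} (hr : r < m) (ε : ℕ → Bool) (i : ℕ → V) :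
    (Finset.univ.filter fun v => ¬ IsFreshStep fX fY ε (Function.update i (r + 1) v) r).card ≤
      m * (CX + CY + 1) := by
  have hsub : (Finset.univ.filter
      fun v => ¬ IsFreshStep fX fY ε (Function.update i (r + 1) v) r) ⊆
      ((Finset.range r).biUnion fun s => Finset.univ.filter fun v =>
        fX (stepEdge (ε r) (i r) v) = fX (walkEdge ε i s)) ∪
      ((Finset.range r).biUnion fun s => Finset.univ.filter fun v =>
        fY (stepEdge (ε r) (i r) v) = fY (walkEdge ε i s)) ∪ (Finset.range (r + 1)).image i := by
    intro v hv
    have hv := (Finset.mem_filter.1 hv).2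
    have hlast : walkEdge ε (Function.update i (r + 1) v) r = stepEdge (ε r) (i r) v := by
      simp [walkEdge]
    have hearly : ∀ s < r, walkEdge ε (Function.update i (r + 1) v) s = walkEdge ε i s :=
      fun s hs => by
        rw [walkEdge, walkEdge, Function.update_of_ne (by omega), Function.update_of_ne (by omega)]
    simp only [Finset.mem_union, Finset.mem_biUnion, Finset.mem_range, Finset.mem_filter,
      Finset.mem_univ, true_and, Finset.mem_image]
    by_contra hcon
    push Not at hcon
    refine hv ⟨fun s hs => ?_, fun s hs => ?_, fun s hs => ?_⟩
    · rw [hlast, hearly s hs]; exact (hcon.1.1 s hs).symm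
    · rw [hlast, hearly s hs]; exact (hcon.1.2 s hs).symm
    · rw [Function.update_self, Function.update_of_ne (by omega)]
      exact (hcon.2 s (by omega)).symm
  have hX' : ∀ t, (Finset.univ.filter fun v => fX (stepEdge (ε r) (i r) v) = t).card ≤ CX :=
    fun t => by
      have := hX (ε r) (i r) t
      rwa [Set.ncard_eq_toFinset_card', Set.toFinset_ofPred] at this
  have hY' : ∀ t, (Finset.univ.filter fun v => fY (stepEdge (ε r) (i r) v) = t).card ≤ CY :=
    fun t => by
      have := hY (ε r) (i r) t
      rwa [Set.ncard_eq_toFinset_card', Set.toFinset_ofPred] at this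
  have b1 := Finset.card_biUnion_le_card_mul (Finset.range r) _ CX fun s _ =>
    hX' (fX (walkEdge ε i s))
  have b2 := Finset.card_biUnion_le_card_mul (Finset.range r) _ CY fun s _ =>
    hY' (fY (walkEdge ε i s))
  have b3 := Finset.card_image_le (s := Finset.range (r + 1)) (f := i)
  rw [Finset.card_range] at b1 b2 b3
  calc _ ≤ _ := Finset.card_le_card hsub
    _ ≤ r * CX + r * CY + (r + 1) := (Finset.card_union_le _ _).trans
        (add_le_add ((Finset.card_union_le _ _).trans (add_le_add b1 b2)) b3)
    _ ≤ m * CX + m * CY + m := by gcongr; omega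
    _ = _ := by ring

-- A weighted count: a fresh step gets weight `1/n` and any other step weight `1`, so each step
-- contributes a bounded sum over its end. A walk with few fresh steps has total weight at least
-- `n^(-m/2)`.
open Classical in
theorem card_few_freshSteps_le {CX CY : ℕ} (hX : BoundedMultiplicity fX CX)
    (hY : BoundedMultiplicity fY CY) (m : ℕ) (ε : ℕ → Bool) :
    ((Finset.univ.filter fun p : Fin (m + 1) → V =>
      2 * (freshSteps fX fY ε (finSeq p) (m + 1)).card < m + 1).card : ℝ) ≤
    Fintype.card V * ((1 + m * (CX + CY + 1) : ℕ) : ℝ) ^ m * Real.sqrt (Fintype.card V) ^ m := by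
  set n := Fintype.card V with hn
  rcases Nat.eq_zero_or_pos n with h0 | hpos
  · have : IsEmpty V := Fintype.card_eq_zero_iff.1 h0
    simp [h0]
  set S := Real.sqrt n with hS
  have hn1 : (1 : ℝ) ≤ n := by exact_mod_cast hpos
  have hS1 : 1 ≤ S := Real.one_le_sqrt.2 hn1
  have hSS : S * S = n := Real.mul_self_sqrt (by positivity)
  let w : ℕ → (ℕ → V) → ℝ := fun r i => if IsFreshStep fX fY ε i r then (n : ℝ)⁻¹ else 1
  have key := sum_prod_le_of_sum_update_le (V := V) m w
    (fun r i => by simp only [w]; split_ifs <;> positivity)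
    (fun r i j h => by simp only [w, isFreshStep_congr fX fY h])
    (D := ((1 + m * (CX + CY + 1) : ℕ) : ℝ)) (fun r hr i => by
      simp only [w]
      rw [Finset.sum_ite, Finset.sum_const, Finset.sum_const, nsmul_eq_mul, nsmul_eq_mul, mul_one,
        Nat.cast_add, Nat.cast_one]
      refine add_le_add ?_ (by exact_mod_cast card_not_isFreshStep_le fX fY hX hY hr ε i)
      rw [← div_eq_mul_inv]
      refine div_le_one_of_le₀ ?_ (by positivity)
      exact_mod_cast Finset.card_le_univ _)
  have hlow : ((Finset.univ.filter fun p : Fin (m + 1) → V =>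
      2 * (freshSteps fX fY ε (finSeq p) (m + 1)).card < m + 1).card : ℝ) * (S ^ m)⁻¹ ≤
      ∑ p : Fin (m + 1) → V, ∏ r ∈ Finset.range m, w r (finSeq p) := by
    rw [← nsmul_eq_mul, ← Finset.sum_const]
    refine (Finset.sum_le_sum fun p hp => ?_).trans
      (Finset.sum_le_sum_of_subset_of_nonneg (Finset.filter_subset _ _) fun p _ _ =>
        Finset.prod_nonneg fun r _ => by simp only [w]; split_ifs <;> positivity)
    have hp := (Finset.mem_filter.1 hp).2
    simp only [w]
    rw [Finset.prod_ite, Finset.prod_const_one, mul_one, Finset.prod_const, ← hSS, ← pow_two,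
      inv_pow, ← pow_mul]
    refine inv_anti₀ (by positivity) (pow_le_pow_right₀ hS1 ?_)
    -- Only the first `m` steps carry weights, since the closing step has no free end. Strict
    -- inequality with `m + 1` gives at most `m`, which saves the factor `√n`.
    refine (Nat.mul_le_mul_left 2 (Finset.card_le_card fun r hr => ?_)).trans
      (Nat.le_of_lt_succ hp)
    rw [Finset.mem_filter, Finset.mem_range] at hr
    exact Finset.mem_filter.2 ⟨Finset.mem_range.2 (by omega), hr.2⟩
  have hpos' : 0 < S ^ m := by positivity
  have := hlow.trans key
  rwa [← div_eq_mul_inv, div_le_iff₀ hpos'] at this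

/-! ### Closed walks -/

/-- The periodic sequence with the terms of `g`. -/
def zmodSeq {k : ℕ} {α : Type*} (g : ZMod k → α) (r : ℕ) : α := g r

/-- The directed edge used by a closed walk at time `q`. -/
def closedEdge {V : Type*} {k : ℕ} (ε : ZMod k → Bool) (g : ZMod k → V) (q : ZMod k) : V × V :=
  stepEdge (ε q) (g q) (g (q + 1))

omit [Fintype V] in
theorem walkEdge_zmodSeq {k : ℕ} (ε : ZMod k → Bool) (g : ZMod k → V) (t : ZMod k) (r : ℕ) :
    walkEdge (zmodSeq fun q => ε (q + t)) (zmodSeq fun q => g (q + t)) r =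
      closedEdge ε g (r + t) := by
  simp only [walkEdge, closedEdge, zmodSeq, Nat.cast_add, Nat.cast_one]
  rw [add_right_comm]

/-- A closed walk which, from some starting point, has few fresh steps. -/
def IsDegenerate {k : ℕ} (ε : ZMod k → Bool) (g : ZMod k → V) : Prop :=
  ∃ t, 2 * (freshSteps fX fY (zmodSeq fun q => ε (q + t)) (zmodSeq fun q => g (q + t)) k).card < k

open Classical in
theorem card_isDegenerate_le {CX CY : ℕ} (hX : BoundedMultiplicity fX CX)
    (hY : BoundedMultiplicity fY CY) (m : ℕ) (ε : ZMod (m + 1) → Bool) :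
    ((Finset.univ.filter (IsDegenerate fX fY ε)).card : ℝ) ≤ (m + 1 : ℕ) *
      (Fintype.card V * ((1 + m * (CX + CY + 1) : ℕ) : ℝ) ^ m *
        Real.sqrt (Fintype.card V) ^ m) := by
  have hsub : Finset.univ.filter (IsDegenerate fX fY ε) ⊆
      (Finset.univ : Finset (ZMod (m + 1))).biUnion fun t => Finset.univ.filter fun g =>
        2 * (freshSteps fX fY (zmodSeq fun q => ε (q + t)) (zmodSeq fun q => g (q + t))
          (m + 1)).card < m + 1 := by
    intro g hg
    obtain ⟨t, ht⟩ := (Finset.mem_filter.1 hg).2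
    exact Finset.mem_biUnion.2 ⟨t, Finset.mem_univ _, Finset.mem_filter.2 ⟨Finset.mem_univ _, ht⟩⟩
  have hrot : ∀ t : ZMod (m + 1), ((Finset.univ.filter fun g : ZMod (m + 1) → V =>
        2 * (freshSteps fX fY (zmodSeq fun q => ε (q + t)) (zmodSeq fun q => g (q + t))
          (m + 1)).card < m + 1).card : ℝ) ≤ Fintype.card V *
      ((1 + m * (CX + CY + 1) : ℕ) : ℝ) ^ m * Real.sqrt (Fintype.card V) ^ m := by
    intro t
    refine le_trans ?_ (card_few_freshSteps_le fX fY hX hY m (zmodSeq fun q => ε (q + t)))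
    refine Nat.cast_le.2 (Finset.card_le_card_of_injOn
      (fun g : ZMod (m + 1) → V => fun q : ZMod (m + 1) => g (q + t)) ?_ ?_)
    · intro g hg
      exact Finset.mem_filter.2 ⟨Finset.mem_univ _, (Finset.mem_filter.1 hg).2⟩
    · intro g _ g' _ h
      ext q
      have := congrFun h (q - t)
      simpa using this
  calc _ ≤ _ := Nat.cast_le.2 ((Finset.card_le_card hsub).trans Finset.card_biUnion_le)
    _ ≤ ∑ _t : ZMod (m + 1), (Fintype.card V * ((1 + m * (CX + CY + 1) : ℕ) : ℝ) ^ m *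
        Real.sqrt (Fintype.card V) ^ m) := by
        rw [Nat.cast_sum]
        exact Finset.sum_le_sum fun t _ => hrot t
    _ = _ := by
        rw [Finset.sum_const, Finset.card_univ, ZMod.card, nsmul_eq_mul]

/-- A parse with empty initial stack forces the walk to close, so the sum over open walks, where the
power counting is exact, loses nothing when restricted to closed ones. -/
theorem sum_parseCount_closed [DecidableEq V] (m : ℕ) (ε : ZMod (m + 1) → Bool) :
    ∑ g : ZMod (m + 1) → V, (parseCount (zmodSeq ε) (zmodSeq g) (m + 1) 0 [] : ℝ) =
      Fintype.card V * stackCount (List.ofFn fun r : Fin (m + 1) => zmodSeq ε r) [] *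
        Real.sqrt (Fintype.card V) ^ (m + 1) := by
  have hall : ∑ p : Fin (m + 2) → V, (parseCount (zmodSeq ε) (finSeq p) (m + 1) 0 [] : ℝ) =
      Fintype.card V * stackCount (List.ofFn fun r : Fin (m + 1) => zmodSeq ε r) [] *
        Real.sqrt (Fintype.card V) ^ (m + 1) := by
    rw [← (Fin.consEquiv fun _ : Fin (m + 1 + 1) => V).sum_comp, Fintype.sum_prod_type]
    have := fun u : V => sum_parseCount (m + 1) (zmodSeq ε) u []
    simp only [List.length_nil, pow_zero, one_mul, List.map_nil] at this
    simp only [Fin.consEquiv, Equiv.coe_fn_mk, this, Finset.sum_const, Finset.card_univ,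
      nsmul_eq_mul, mul_assoc]
  rw [← hall, ← (Fin.snocEquiv fun _ : Fin (m + 1 + 1) => V).sum_comp, Fintype.sum_prod_type,
    Finset.sum_comm]
  refine Finset.sum_congr rfl fun g _ => ?_
  have hlt : ∀ (v : V) (s : ℕ), s < m + 1 →
      finSeq (Fin.snoc (g : Fin (m + 1) → V) v : Fin (m + 2) → V) s = zmodSeq g s := by
    intro v s hs
    rw [finSeq_of_lt _ (show s < m + 2 by omega)]
    exact (Fin.snoc_castSucc (α := fun _ => V) v g ⟨s, hs⟩).trans
      (finSeq_of_lt (m := m) g hs).symm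
  have hlast : ∀ v : V,
      finSeq (Fin.snoc (g : Fin (m + 1) → V) v : Fin (m + 2) → V) (m + 1) = v := by
    intro v
    rw [finSeq_of_lt _ (by omega)]
    exact Fin.snoc_last (α := fun _ => V) v g
  have hwrap : zmodSeq g (m + 1) = zmodSeq g 0 := by
    simp only [zmodSeq]
    congr 1
    rw [ZMod.natCast_self, Nat.cast_zero]
  rw [Fintype.sum_eq_single (zmodSeq g 0)]
  · congr 1
    refine parseCount_congr (fun _ _ => rfl) (fun s hs => ?_) []
    rw [zero_add]
    rcases hs.eq_or_lt with rfl | h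
    · rw [hwrap]; exact (hlast _).symm
    · exact (hlt _ s h).symm
  · intro v hv
    rw [Nat.cast_eq_zero]
    by_contra hne
    have := (exists_match_of_parseCount_pos (Nat.pos_of_ne_zero hne)).2.2
    rw [zero_add] at this
    exact hv ((hlast v).symm.trans (this.trans (hlt v 0 (by omega))))

end Counting

/-! ### Nondegenerate walks -/

section Nondegenerate

variable {V I J : Type*} {fX : V × V → I} {fY : V × V → J} {k : ℕ} [NeZero k]
  {ε : ZMod k → Bool} {g : ZMod k → V}

/-- The labels occur in pairs, at positions with opposite signs. -/
def IsAlternatingPairing {I : Type*} {k : ℕ} (a : ZMod k → I) (ε : ZMod k → Bool) : Prop :=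
  ∀ r, ∃ s, s ≠ r ∧ a s = a r ∧ ε s = (!ε r) ∧ ∀ q, a q = a r → q = r ∨ q = s

theorem exists_subset_newLabels (h : ¬ IsDegenerate fX fY ε g) (t : ZMod k) :
    ∃ S : Finset (ZMod k), k ≤ 2 * S.card ∧ S ⊆ newLabels (fun q => fX (closedEdge ε g q)) t ∧
      S ⊆ newLabels (fun q => fY (closedEdge ε g q)) t ∧
      ∀ r : ℕ, r < k → (r : ZMod k) + t ∈ S →
        ∀ s ≤ r, g (((r + 1 : ℕ) : ZMod k) + t) ≠ g ((s : ZMod k) + t) := by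
  classical
  set F := freshSteps fX fY (zmodSeq fun q => ε (q + t)) (zmodSeq fun q => g (q + t)) k with hF
  have hmem : ∀ r ∈ F, r < k ∧ IsFreshStep fX fY (zmodSeq fun q => ε (q + t))
      (zmodSeq fun q => g (q + t)) r := fun r hr => by
    have := Finset.mem_filter.1 hr
    exact ⟨Finset.mem_range.1 this.1, this.2⟩
  have hinj : Set.InjOn (fun r : ℕ => (r : ZMod k) + t) (Set.Iio k) := fun r hr r' hr' he => by
    have := congrArg ZMod.val (add_right_cancel he)
    rwa [ZMod.val_cast_of_lt hr, ZMod.val_cast_of_lt hr'] at this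
  have hpos : ∀ r < k, ((r : ZMod k) + t - t).val = r := fun r hr => by
    rw [add_sub_cancel_right, ZMod.val_cast_of_lt hr]
  have hs : ∀ s : ZMod k, s = ((s - t).val : ZMod k) + t := fun s => by
    rw [ZMod.natCast_zmod_val, sub_add_cancel]
  refine ⟨F.image fun r : ℕ => (r : ZMod k) + t, ?_, fun q hq => ?_, fun q hq => ?_,
    fun r hr hrS => ?_⟩
  · rw [Finset.card_image_of_injOn (hinj.mono fun r hr => (hmem r hr).1)]
    by_contra hlt
    exact h ⟨t, by rw [← hF]; omega⟩
  · obtain ⟨r, hr, rfl⟩ := Finset.mem_image.1 hq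
    obtain ⟨hrk, h1, -, -⟩ := hmem r hr
    refine mem_newLabels.2 fun s hlt => ?_
    rw [hpos r hrk] at hlt
    have := h1 _ hlt
    rwa [walkEdge_zmodSeq, walkEdge_zmodSeq, ← hs] at this
  · obtain ⟨r, hr, rfl⟩ := Finset.mem_image.1 hq
    obtain ⟨hrk, -, h1, -⟩ := hmem r hr
    refine mem_newLabels.2 fun s hlt => ?_
    rw [hpos r hrk] at hlt
    have := h1 _ hlt
    rwa [walkEdge_zmodSeq, walkEdge_zmodSeq, ← hs] at this
  · obtain ⟨r', hr', he⟩ := Finset.mem_image.1 hrS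
    obtain rfl := hinj (hmem r' hr').1 hr he
    exact (hmem r' hr').2.2.2

/-- Nondegeneracy makes the X-pairing and the Y-pairing equal, and the two labels together determine
the edge. -/
theorem closedEdge_pairs (hinj : Function.Injective fun e => (fX e, fY e))
    (h : ¬ IsDegenerate fX fY ε g)
    (hX : ∀ r, ∃ s, s ≠ r ∧ fX (closedEdge ε g s) = fX (closedEdge ε g r))
    (hY : ∀ r, ∃ s, s ≠ r ∧ fY (closedEdge ε g s) = fY (closedEdge ε g r)) (r : ZMod k) :
    ∃ s, s ≠ r ∧ closedEdge ε g s = closedEdge ε g r := by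
  obtain ⟨s, hsr, hs⟩ := hX r
  refine ⟨s, hsr, hinj (Prod.ext hs ?_)⟩
  refine label_eq_of_label_eq (a := fun q => fX (closedEdge ε g q))
    (b := fun q => fY (closedEdge ε g q)) hX hY (fun t => ?_) hsr hs
  obtain ⟨S, h1, h2, h3, -⟩ := exists_subset_newLabels h t
  exact ⟨S, h1, h2, h3⟩

theorem parseCount_eq_one_of_pairs [DecidableEq V] (h : ¬ IsDegenerate fX fY ε g)
    (hP : ∀ r, ∃ s, s ≠ r ∧ closedEdge ε g s = closedEdge ε g r) :
    parseCount (zmodSeq ε) (zmodSeq g) k 0 [] = 1 := by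
  have hX : ∀ r, ∃ s, s ≠ r ∧ fX (closedEdge ε g s) = fX (closedEdge ε g r) := fun r => by
    obtain ⟨s, h1, h2⟩ := hP r
    exact ⟨s, h1, by rw [h2]⟩
  obtain ⟨S, hS, hSX, -, hSv⟩ := exists_subset_newLabels h 0
  have hcard := two_mul_card_newLabels_le hX 0
  have hSeq := Finset.eq_of_subset_of_card_le hSX (by omega)
  have hpair : ∀ r s q : ZMod k, s ≠ r → fX (closedEdge ε g s) = fX (closedEdge ε g r) →
      fX (closedEdge ε g q) = fX (closedEdge ε g r) → q = r ∨ q = s := fun r s q hsr hs hq =>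
    eq_or_eq_of_le_card_newLabels hX (t := 0) (by rw [← hSeq]; exact hS) hsr hs hq
  have hedge : ∀ r : ℕ, walkEdge (zmodSeq ε) (zmodSeq g) r = closedEdge ε g r := fun r => by
    simpa using walkEdge_zmodSeq ε g 0 r
  have hne : ∀ r < k, ∀ s < k, (r : ZMod k) = s → r = s := fun r hr s hs he => by
    have := congrArg ZMod.val he
    rwa [ZMod.val_cast_of_lt hr, ZMod.val_cast_of_lt hs] at this
  refine parseCount_eq_one (by simp [zmodSeq]) (fun r hr => ?_)
    fun r hr s hs q hq h1 h2 => ?_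
  -- The fresh positions `S` exhaust the new X-labels. Outside `S` the X-label is a repetition, and
  -- since labels occur in pairs, the edge itself is repeated.
  · by_cases hrS : (r : ZMod k) ∈ S
    · refine Or.inr fun s hs => ?_
      simpa [zmodSeq] using hSv r hr (by simpa using hrS) s hs
    · left
      rw [hSeq, mem_newLabels] at hrS
      unfold IsNewLabel at hrS
      push Not at hrS
      obtain ⟨s, hlt, hs⟩ := hrS
      rw [sub_zero, sub_zero, ZMod.val_cast_of_lt hr] at hlt
      refine ⟨s.val, hlt, ?_⟩
      rw [hedge, hedge, ZMod.natCast_zmod_val]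
      obtain ⟨p, hpr, hp⟩ := hP r
      rcases hpair r p s hpr (by rw [hp]) hs with rfl | rfl
      · rfl
      · exact hp
  · rw [hedge, hedge] at h1 h2
    rcases hpair r s q (fun he => by have := hne s (by omega) r hr he; omega)
      (by rw [h1]) (by rw [h2]) with he | he
    · exact Or.inl (hne q hq r hr he)
    · exact Or.inr (hne q hq s (by omega) he)

theorem exists_opposite_of_parseCount_pos [DecidableEq V]
    (h : 0 < parseCount (zmodSeq ε) (zmodSeq g) k 0 []) (r : ZMod k) :
    ∃ s, s ≠ r ∧ closedEdge ε g s = closedEdge ε g r ∧ ε s = (!ε r) := by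
  have hedge : ∀ r : ℕ, walkEdge (zmodSeq ε) (zmodSeq g) r = closedEdge ε g r := fun r => by
    simpa using walkEdge_zmodSeq ε g 0 r
  have hr := ZMod.val_lt r
  rcases (exists_match_of_parseCount_pos h).2.1 r.val (Nat.zero_le _) (by omega) with
    ⟨s, -, h1, h2, h3, h4⟩ | h'
  · rw [hedge, hedge, ZMod.natCast_zmod_val] at h4
    refine ⟨s, ?_, h4, ?_⟩
    · rintro rfl
      rw [ZMod.val_cast_of_lt (by omega)] at h2
      exact h2 rfl
    · simpa [zmodSeq] using h3
  · simp [stackEdges] at h'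

theorem isAlternatingPairing_of_card {a : ZMod k → I}
    (hP : ∀ r, ∃ s, s ≠ r ∧ a s = a r ∧ ε s = (!ε r)) {S : Finset (ZMod k)}
    (hS : k ≤ 2 * S.card) {t : ZMod k} (hSa : S ⊆ newLabels a t) : IsAlternatingPairing a ε := by
  intro r
  have := Finset.card_le_card hSa
  obtain ⟨s, h1, h2, h3⟩ := hP r
  refine ⟨s, h1, h2, h3, fun q hq => eq_or_eq_of_le_card_newLabels (t := t)
    (fun r => ?_) (by omega) h1 h2 hq⟩
  obtain ⟨s, h1, h2, -⟩ := hP r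
  exact ⟨s, h1, h2⟩

theorem isAlternatingPairing_closedEdge (h : ¬ IsDegenerate fX fY ε g)
    (hP : ∀ r, ∃ s, s ≠ r ∧ closedEdge ε g s = closedEdge ε g r ∧ ε s = (!ε r)) :
    IsAlternatingPairing (fun q => fX (closedEdge ε g q)) ε ∧
      IsAlternatingPairing (fun q => fY (closedEdge ε g q)) ε := by
  obtain ⟨S, hS, hSX, hSY, -⟩ := exists_subset_newLabels h 0
  refine ⟨isAlternatingPairing_of_card (fun r => ?_) hS hSX,
    isAlternatingPairing_of_card (fun r => ?_) hS hSY⟩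
  all_goals
    obtain ⟨s, h1, h2, h3⟩ := hP r
    exact ⟨s, h1, by simp only [h2], h3⟩

/-- The properties of the mixed moments of a family of independent, centred variables with variance
`1`, and bounded moments, which determine the limit. -/
structure IsMomentFunction {I : Type*} {k : ℕ} (ε : ZMod k → Bool) (h : (ZMod k → I) → ℂ)
    (B : ℝ) : Prop where
  bound : ∀ a, ‖h a‖ ≤ B
  eq_zero : ∀ a, (∃ r, ∀ s, s ≠ r → a s ≠ a r) → h a = 0
  eq_one : ∀ a, IsAlternatingPairing a ε → h a = 1

variable {hx : (ZMod k → I) → ℂ} {hy : (ZMod k → J) → ℂ} {BX BY : ℝ}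

/-- Nonzero moments give paired edges and hence a parse. A parse gives pairs with opposite signs,
for which both moments are `1` and the parse is unique. -/
theorem mul_eq_parseCount [DecidableEq V] (hhx : IsMomentFunction ε hx BX)
    (hhy : IsMomentFunction ε hy BY) (hinj : Function.Injective fun e => (fX e, fY e))
    (h : ¬ IsDegenerate fX fY ε g) :
    hx (fun q => fX (closedEdge ε g q)) * hy (fun q => fY (closedEdge ε g q)) =
      parseCount (zmodSeq ε) (zmodSeq g) k 0 [] := by
  rcases Nat.eq_zero_or_pos (parseCount (zmodSeq ε) (zmodSeq g) k 0 []) with h0 | hpos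
  · rw [h0, Nat.cast_zero]
    by_contra hne
    have hX := left_ne_zero_of_mul hne
    have hY := right_ne_zero_of_mul hne
    have := parseCount_eq_one_of_pairs h (closedEdge_pairs hinj h
      (fun r => by by_contra hc; push Not at hc; exact hX (hhx.eq_zero _ ⟨r, hc⟩))
      (fun r => by by_contra hc; push Not at hc; exact hY (hhy.eq_zero _ ⟨r, hc⟩)))
    omega
  · have hP := exists_opposite_of_parseCount_pos hpos
    rw [hhx.eq_one _ (isAlternatingPairing_closedEdge h hP).1, hhy.eq_one _ (isAlternatingPairing_closedEdge h hP).2,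
      parseCount_eq_one_of_pairs h fun r => by
        obtain ⟨s, h1, h2, -⟩ := hP r
        exact ⟨s, h1, h2⟩]
    simp

end Nondegenerate

/-- The sum over closed walks of the moments, compared with the number of parses. -/
theorem norm_sum_sub_stackCount_le {V I J : Type*} [Fintype V] {fX : V × V → I} {fY : V × V → J}
    {CX CY m : ℕ} (hX : BoundedMultiplicity fX CX) (hY : BoundedMultiplicity fY CY)
    (hinj : Function.Injective fun e => (fX e, fY e)) {ε : ZMod (m + 1) → Bool}
    {hx : (ZMod (m + 1) → I) → ℂ} {hy : (ZMod (m + 1) → J) → ℂ} {BX BY : ℝ}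
    (hhx : IsMomentFunction ε hx BX) (hhy : IsMomentFunction ε hy BY) :
    ‖∑ g : ZMod (m + 1) → V,
        hx (fun q => fX (closedEdge ε g q)) * hy (fun q => fY (closedEdge ε g q)) -
      Fintype.card V * stackCount (List.ofFn fun r : Fin (m + 1) => zmodSeq ε r) [] *
        (Real.sqrt (Fintype.card V) : ℂ) ^ (m + 1)‖ ≤
    (BX * BY + 2 ^ (m + 1)) * ((m + 1 : ℕ) * (1 + m * (CX + CY + 1) : ℕ) ^ m) *
      (Fintype.card V * Real.sqrt (Fintype.card V) ^ m) := by
  classical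
  have hsum := congrArg (fun x : ℝ => (x : ℂ)) (sum_parseCount_closed (V := V) m ε)
  push_cast at hsum
  rw [← hsum, ← Finset.sum_sub_distrib]
  have hterm : ∀ g : ZMod (m + 1) → V,
      ‖hx (fun q => fX (closedEdge ε g q)) * hy (fun q => fY (closedEdge ε g q)) -
        (parseCount (zmodSeq ε) (zmodSeq g) (m + 1) 0 [] : ℂ)‖ ≤
      if IsDegenerate fX fY ε g then BX * BY + 2 ^ (m + 1) else 0 := by
    intro g
    split_ifs with hd
    · refine (norm_sub_le _ _).trans (add_le_add ?_ ?_)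
      · rw [norm_mul]
        exact mul_le_mul (hhx.bound _) (hhy.bound _) (norm_nonneg _)
          ((norm_nonneg _).trans (hhx.bound fun q => fX (closedEdge ε g q)))
      · rw [Complex.norm_natCast]
        exact_mod_cast parseCount_le _ _ _ _ _
    · rw [mul_eq_parseCount hhx hhy hinj hd, sub_self, norm_zero]
  refine (norm_sum_le _ _).trans ((Finset.sum_le_sum fun g _ => hterm g).trans ?_)
  rw [← Finset.sum_filter, Finset.sum_const, nsmul_eq_mul, mul_comm, mul_assoc]
  -- Nonnegativity of `BX` and `BY` is obtained by evaluating the moment functions at some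
  -- labelling, which needs a vertex.
  rcases isEmpty_or_nonempty V with hV | ⟨⟨v⟩⟩
  · have : Finset.univ.filter (IsDegenerate fX fY ε) = ∅ := by
      ext g
      exact (hV.false (g 0)).elim
    simp
  · have hBX := (norm_nonneg _).trans (hhx.bound fun q => fX (v, v))
    have hBY := (norm_nonneg _).trans (hhy.bound fun q => fY (v, v))
    refine mul_le_mul_of_nonneg_left ?_ (by positivity)
    refine (card_isDegenerate_le fX fY hX hY m ε).trans (le_of_eq ?_)
    ring

/-- The error is smaller than the main term by a factor of order `1/√n`. -/
theorem tendsto_normalized_sum {f : ℕ → ℂ} {C : ℝ} {m : ℕ} (s : ℕ)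
    (h : ∀ n : ℕ, ‖f n - n * s * (Real.sqrt n : ℂ) ^ (m + 1)‖ ≤ C * (n * Real.sqrt n ^ m)) :
    Tendsto (fun n : ℕ => (n : ℂ)⁻¹ * ((Real.sqrt n : ℂ)⁻¹ ^ (m + 1) * f n)) atTop
      (𝓝 (s : ℂ)) := by
  rw [tendsto_iff_norm_sub_tendsto_zero]
  have hlim : Tendsto (fun n : ℕ => C * (Real.sqrt n)⁻¹) atTop (𝓝 0) := by
    have := (tendsto_inv_atTop_zero.comp
      (Real.tendsto_sqrt_atTop.comp tendsto_natCast_atTop_atTop)).const_mul C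
    simpa using this
  refine squeeze_zero' (Eventually.of_forall fun _ => norm_nonneg _) ?_ hlim
  filter_upwards [eventually_gt_atTop 0] with n hn
  have hn' : (0 : ℝ) < n := by exact_mod_cast hn
  have hS : 0 < Real.sqrt n := Real.sqrt_pos.2 hn'
  have hnC : (n : ℂ) ≠ 0 := by exact_mod_cast hn.ne'
  have hSC : (Real.sqrt n : ℂ) ≠ 0 := by exact_mod_cast hS.ne'
  have : (n : ℂ)⁻¹ * ((Real.sqrt n : ℂ)⁻¹ ^ (m + 1) * f n) - s =
      (n : ℂ)⁻¹ * (Real.sqrt n : ℂ)⁻¹ ^ (m + 1) *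
        (f n - n * s * (Real.sqrt n : ℂ) ^ (m + 1)) := by
    rw [inv_pow]
    field_simp
  rw [this, norm_mul, norm_mul, norm_pow, norm_inv, norm_inv, Complex.norm_natCast,
    Complex.norm_of_nonneg hS.le]
  calc _ ≤ (n : ℝ)⁻¹ * (Real.sqrt n)⁻¹ ^ (m + 1) * (C * (n * Real.sqrt n ^ m)) :=
        mul_le_mul_of_nonneg_left (h n) (by positivity)
    _ = _ := by
        rw [inv_pow]
        field_simp
        rw [pow_succ]
        ring

/-! ### Mixed moments of independent families -/

/-- The complex conjugate of `z` if `e` holds, and `z` otherwise. -/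
noncomputable def conjIf (e : Bool) (z : ℂ) : ℂ := if e then star z else z

theorem continuous_conjIf (e : Bool) : Continuous (conjIf e) := by
  cases e
  · exact continuous_id
  · exact continuous_star

theorem norm_conjIf (e : Bool) (z : ℂ) : ‖conjIf e z‖ = ‖z‖ := by
  cases e <;> simp [conjIf]

theorem conjIf_mul_conjIf_not (e : Bool) (z : ℂ) :
    conjIf e z * conjIf (!e) z = ((‖z‖ ^ 2 : ℝ) : ℂ) := by
  cases e
  · simpa [conjIf] using Complex.mul_conj' z
  · simpa [conjIf] using Complex.conj_mul' z

/-- A crude substitute for Hölder's inequality: the product is at most a power of its largest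
factor. -/
theorem prod_le_sum_pow_card {ι : Type*} [Fintype ι] [Nonempty ι] (b : ι → ℝ)
    (hb : ∀ i, 0 ≤ b i) : ∏ i, b i ≤ ∑ i, b i ^ Fintype.card ι := by
  obtain ⟨j, -, hj⟩ := Finset.exists_max_image Finset.univ b Finset.univ_nonempty
  calc ∏ i, b i ≤ ∏ _i : ι, b j :=
        Finset.prod_le_prod (fun i _ => hb i) fun i _ => hj i (Finset.mem_univ _)
    _ = b j ^ Fintype.card ι := by rw [Finset.prod_const, Finset.card_univ]
    _ ≤ _ := Finset.single_le_sum (f := fun i => b i ^ Fintype.card ι)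
        (fun i _ => pow_nonneg (hb i) _) (Finset.mem_univ j)

variable {Ω : Type*} [MeasurableSpace Ω] {P : Measure Ω} [IsProbabilityMeasure P] {I : Type*}
  {x : I → LInfMinus P}

theorem LInfMinus.aestronglyMeasurable (f : LInfMinus P) : AEStronglyMeasurable (f : Ω → ℂ) P :=
  (f.2 1 le_rfl ENNReal.one_ne_top).1

-- Factors with the same label are grouped, and distinct groups are independent.
open Classical in
theorem IsInputFamily.integral_prod_eq (hx : IsInputFamily x) {k : ℕ} [NeZero k]
    (ε : ZMod k → Bool) (a : ZMod k → I) :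
    ∫ ω, ∏ r, conjIf (ε r) ((x (a r) : Ω → ℂ) ω) ∂P =
      ∏ α : Finset.univ.image a,
        ∫ ω, ∏ r ∈ Finset.univ.filter fun r => a r = α, conjIf (ε r) ((x α : Ω → ℂ) ω) ∂P := by
  have hind : iIndepFun (fun α : Finset.univ.image a => (x α : Ω → ℂ)) P :=
    hx.indep.precomp Subtype.val_injective
  rw [← hind.integral_fun_prod_comp
    (f := fun (α : Finset.univ.image a) z => ∏ r ∈ Finset.univ.filter fun r => a r = α, conjIf (ε r) z)
    (fun α => (LInfMinus.aestronglyMeasurable _).aemeasurable)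
    (fun α => (continuous_finsetProd _ fun r _ => continuous_conjIf _).aestronglyMeasurable)]
  congr 1
  ext ω
  rw [Finset.prod_coe_sort (Finset.univ.image a) fun α =>
    ∏ r ∈ Finset.univ.filter fun r => a r = α, conjIf (ε r) ((x α : Ω → ℂ) ω)]
  rw [← Finset.prod_fiberwise_of_maps_to (g := a) (t := Finset.univ.image a)
    fun r _ => Finset.mem_image_of_mem a (Finset.mem_univ r)]
  refine Finset.prod_congr rfl fun α _ => Finset.prod_congr rfl fun r hr => ?_
  rw [(Finset.mem_filter.1 hr).2]

theorem IsInputFamily.exists_isMomentFunction (hx : IsInputFamily x) {k : ℕ} [NeZero k]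
    (ε : ZMod k → Bool) :
    ∃ B, IsMomentFunction ε
      (fun a : ZMod k → I => ∫ ω, ∏ r, conjIf (ε r) ((x (a r) : Ω → ℂ) ω) ∂P) B := by
  classical
  obtain ⟨C, hC⟩ := hx.moments_bounded k
  refine ⟨k * C, fun a => ?_, fun a ⟨r, hr⟩ => ?_, fun a ha => ?_⟩
  · have hk1 : (1 : ℝ≥0∞) ≤ k := by exact_mod_cast NeZero.one_le
    have hint : ∀ r, Integrable (fun ω => ‖(x (a r) : Ω → ℂ) ω‖ ^ k) P := fun r =>
      ((x (a r)).2 k hk1 (ENNReal.natCast_ne_top k)).integrable_norm_pow (NeZero.ne k)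
    calc _ ≤ ∫ ω, ‖∏ r, conjIf (ε r) ((x (a r) : Ω → ℂ) ω)‖ ∂P := norm_integral_le_integral_norm _
      _ ≤ ∫ ω, ∑ r, ‖(x (a r) : Ω → ℂ) ω‖ ^ k ∂P := by
          refine integral_mono_of_nonneg (Eventually.of_forall fun ω => norm_nonneg _)
            (integrable_finsetSum _ fun r _ => hint r) (Eventually.of_forall fun ω => ?_)
          simp only [norm_prod, norm_conjIf]
          have := prod_le_sum_pow_card (fun r => ‖(x (a r) : Ω → ℂ) ω‖) fun r => norm_nonneg _
          rwa [ZMod.card] at this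
      _ = ∑ r, ∫ ω, ‖(x (a r) : Ω → ℂ) ω‖ ^ k ∂P := integral_finsetSum _ fun r _ => hint r
      _ ≤ ∑ _r : ZMod k, C := Finset.sum_le_sum fun r _ => hC _
      _ = k * C := by rw [Finset.sum_const, Finset.card_univ, ZMod.card, nsmul_eq_mul]
  · rw [hx.integral_prod_eq]
    refine Finset.prod_eq_zero (Finset.mem_univ
      ⟨a r, Finset.mem_image_of_mem a (Finset.mem_univ r)⟩) ?_
    -- An isolated label contributes a mean or its conjugate, which vanishes.
    have : Finset.univ.filter (fun s => a s = a r) = {r} := by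
      ext s
      simp only [Finset.mem_filter, Finset.mem_univ, true_and, Finset.mem_singleton]
      refine ⟨fun h => ?_, fun h => by rw [h]⟩
      by_contra hne
      exact hr s hne h
    simp only [this, Finset.prod_singleton]
    have h0 := hx.mean_zero (a r)
    cases ε r
    · exact h0
    · have := integral_conj (μ := P) (f := (x (a r) : Ω → ℂ))
      simp only [conjIf, if_true]
      refine this.trans ?_
      rw [h0, map_zero]
  · rw [hx.integral_prod_eq]
    refine Finset.prod_eq_one fun α _ => ?_
    obtain ⟨α, hα⟩ := α
    obtain ⟨r, -, rfl⟩ := Finset.mem_image.1 hα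
    obtain ⟨s, hsr, hs, hε, hpair⟩ := ha r
    -- Each group is a variable times its conjugate, with expectation `E|x|^2 = 1`.
    have : Finset.univ.filter (fun q => a q = a r) = {r, s} := by
      ext q
      simp only [Finset.mem_filter, Finset.mem_univ, true_and, Finset.mem_singleton,
        Finset.mem_insert]
      refine ⟨hpair q, ?_⟩
      rintro (rfl | rfl)
      · rfl
      · exact hs
    simp only [this, Finset.prod_pair hsr.symm, hε, conjIf_mul_conjIf_not]
    refine (integral_ofReal (𝕜 := ℂ) (f := fun ω => ‖(x (a r) : Ω → ℂ) ω‖ ^ 2)).trans ?_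
    rw [hx.unit_variance]
    exact Complex.ofReal_one

omit [MeasurableSpace Ω] in
theorem measurable_prod_conjIf {k : ℕ} [NeZero k] (ε : ZMod k → Bool) (a : ZMod k → I) :
    Measurable fun f : I → ℂ => ∏ r, conjIf (ε r) (f (a r)) :=
  Finset.measurable_fun_prod _ fun r _ => (continuous_conjIf (ε r)).measurable.comp
    (measurable_pi_apply (a r))

theorem aestronglyMeasurable_prod_conjIf (x : I → LInfMinus P) {k : ℕ} [NeZero k]
    (ε : ZMod k → Bool) (a : ZMod k → I) :
    AEStronglyMeasurable (fun ω => ∏ r, conjIf (ε r) ((x (a r) : Ω → ℂ) ω)) P :=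
  Finset.aestronglyMeasurable_fun_prod _ fun _ _ =>
    (continuous_conjIf _).comp_aestronglyMeasurable (LInfMinus.aestronglyMeasurable _)

theorem integral_prod_mul_eq {J : Type*} {y : J → LInfMinus P}
    (hxy : IndepFun (fun ω α => (x α : Ω → ℂ) ω) (fun ω β => (y β : Ω → ℂ) ω) P)
    {k : ℕ} [NeZero k] (ε : ZMod k → Bool) (a : ZMod k → I) (b : ZMod k → J) :
    ∫ ω, ∏ r, conjIf (ε r) ((x (a r) : Ω → ℂ) ω * (y (b r) : Ω → ℂ) ω) ∂P =
      (∫ ω, ∏ r, conjIf (ε r) ((x (a r) : Ω → ℂ) ω) ∂P) *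
        ∫ ω, ∏ r, conjIf (ε r) ((y (b r) : Ω → ℂ) ω) ∂P := by
  have hmul : ∀ e z w, conjIf e (z * w) = conjIf e z * conjIf e w := fun e z w => by
    cases e <;> simp [conjIf]
  simp only [hmul, Finset.prod_mul_distrib]
  have hind := hxy.comp (measurable_prod_conjIf ε a) (measurable_prod_conjIf ε b)
  exact hind.integral_fun_mul_eq_mul_integral (aestronglyMeasurable_prod_conjIf x ε a)
    (aestronglyMeasurable_prod_conjIf y ε b)

/-! ### The trace of a product of matrices -/

section Trace

variable {V R : Type*} [Fintype V] [DecidableEq V] [CommRing R]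

/-- Along the path `u, q, v`, `Fin.cons u q` lists the row indices and `Fin.snoc q v` the column
indices. -/
theorem prod_ofFn_apply {m : ℕ} (M : Fin (m + 1) → Matrix V V R) (u v : V) :
    (List.ofFn M).prod u v = ∑ q : Fin m → V, ∏ r : Fin (m + 1),
      M r ((Fin.cons u q : Fin (m + 1) → V) r) ((Fin.snoc q v : Fin (m + 1) → V) r) := by
  induction m generalizing u with
  | zero =>
    simp [Fin.snoc]
  | succ m ih =>
    rw [List.ofFn_succ, List.prod_cons, Matrix.mul_apply,
      ← (Fin.consEquiv fun _ : Fin (m + 1) => V).sum_comp, Fintype.sum_prod_type]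
    refine Finset.sum_congr rfl fun w _ => ?_
    rw [ih, Finset.mul_sum]
    refine Finset.sum_congr rfl fun q _ => ?_
    conv_rhs => rw [Fin.prod_univ_succ]
    simp only [Fin.consEquiv, Equiv.coe_fn_mk, Fin.cons_zero, Fin.cons_succ,
      ← Fin.cons_snoc_eq_snoc_cons]

theorem trace_prod_ofFn {m : ℕ} (M : Fin (m + 1) → Matrix V V R) :
    (List.ofFn M).prod.trace =
      ∑ g : ZMod (m + 1) → V, ∏ r : ZMod (m + 1), M r (g r) (g (r + 1)) := by
  have : ∑ g : ZMod (m + 1) → V, ∏ r : ZMod (m + 1), M r (g r) (g (r + 1)) =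
      ∑ g : Fin (m + 1) → V, ∏ r : Fin (m + 1), M r (g r) (g (r + 1)) := rfl
  rw [this, ← (Fin.consEquiv fun _ : Fin (m + 1) => V).sum_comp, Fintype.sum_prod_type,
    Matrix.trace]
  refine Finset.sum_congr rfl fun u _ => ?_
  rw [Matrix.diag_apply, prod_ofFn_apply]
  refine Finset.sum_congr rfl fun q _ => Finset.prod_congr rfl fun r _ => ?_
  simp only [Fin.consEquiv, Equiv.coe_fn_mk]
  congr 1
  cases r using Fin.lastCases with
  | last => rw [Fin.last_add_one, Fin.cons_zero]; exact Fin.snoc_last (α := fun _ => V) u q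
  | cast s =>
    rw [Fin.coeSucc_eq_succ, Fin.cons_succ]
    exact Fin.snoc_castSucc (α := fun _ => V) u q s

end Trace

/-! ### Words and linear extension -/

theorem span_words_eq_top : Submodule.span ℂ (Set.range fun w : List Bool =>
    (w.map (FreeAlgebra.ι ℂ)).prod) = (⊤ : Submodule ℂ (FreeAlgebra ℂ Bool)) := by
  rw [eq_top_iff]
  rintro Q -
  set S := Submodule.span ℂ (Set.range fun w : List Bool => (w.map (FreeAlgebra.ι ℂ)).prod)
  have hmul : ∀ a b, a ∈ S → b ∈ S → a * b ∈ S := by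
    intro a b ha hb
    have := Submodule.mul_mem_mul ha hb
    rw [Submodule.span_mul_span] at this
    refine Submodule.span_mono ?_ this
    rintro _ ⟨_, ⟨w, rfl⟩, _, ⟨w', rfl⟩, rfl⟩
    exact ⟨w ++ w', by simp⟩
  induction Q using FreeAlgebra.induction with
  | grade0 c =>
    rw [Algebra.algebraMap_eq_smul_one]
    exact S.smul_mem c (Submodule.subset_span ⟨[], by simp⟩)
  | grade1 e => exact Submodule.subset_span ⟨[e], by simp⟩
  | mul a b ha hb => exact hmul a b ha hb
  | add a b ha hb => exact S.add_mem ha hb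

theorem starDistribution_word {A : Type*} [Ring A] [StarRing A] [Algebra ℂ A] (φ : A →ₗ[ℂ] ℂ)
    (a : A) (w : List Bool) : starDistribution φ a (w.map (FreeAlgebra.ι ℂ)).prod =
      φ (w.map fun e => if e then star a else a).prod := by
  simp only [starDistribution, LinearMap.comp_apply, AlgHom.toLinearMap_apply, map_list_prod,
    List.map_map]
  congr 3
  ext e
  simp

theorem convergesInStarDistribution_of_words {A : ℕ → Type*} [∀ n, Ring (A n)]
    [∀ n, StarRing (A n)] [∀ n, Algebra ℂ (A n)] (φ : ∀ n, A n →ₗ[ℂ] ℂ) (a : ∀ n, A n)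
    {B : Type*} [Ring B] [StarRing B] [Algebra ℂ B] (ψ : B →ₗ[ℂ] ℂ) (b : B)
    (h : ∀ w : List Bool, Tendsto
      (fun n => φ n (w.map fun e => if e then star (a n) else a n).prod) atTop
      (𝓝 (ψ (w.map fun e => if e then star b else b).prod))) :
    ConvergesInStarDistribution φ a ψ b := by
  intro Q
  have hQ : Q ∈ Submodule.span ℂ (Set.range fun w : List Bool =>
      (w.map (FreeAlgebra.ι ℂ)).prod) := span_words_eq_top ▸ Submodule.mem_top
  induction hQ using Submodule.span_induction with
  | mem Q hQ =>
    obtain ⟨w, rfl⟩ := hQ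
    simpa only [starDistribution_word] using h w
  | zero => simp
  | add Q Q' _ _ hQ hQ' => simpa only [map_add] using hQ.add hQ'
  | smul c Q _ hQ => simpa only [map_smul] using hQ.const_smul c

/-! ### Patterned random matrices -/

section Matrices

variable {d d' : ℕ}

/-- A link function as a labelling of the entries of an `n × n` matrix. -/
def linkLabel (L : ℕ+ × ℕ+ → Fin d → ℤ) (n : ℕ) (e : Fin n × Fin n) : Fin d → ℤ :=
  L (Nat.succPNat e.1, Nat.succPNat e.2)

theorem boundedMultiplicity_linkLabel {L : ℕ+ × ℕ+ → Fin d → ℤ} (hL : maxMultiplicity L < ⊤)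
    (n : ℕ) : BoundedMultiplicity (linkLabel L n) (maxMultiplicity L).toNat := by
  intro e u t
  have hn : 0 < n := u.pos
  have hinj : ∀ T : Set (Fin n), Set.InjOn (fun v : Fin n => Nat.succPNat v) T :=
    fun T v _ v' _ h => Fin.ext (Nat.succPNat_injective h)
  have hle : ∀ v : Fin n, Nat.succPNat v ≤ (⟨n, hn⟩ : ℕ+) := fun v => v.isLt
  by_cases ht : t ∈ Set.range L
  · rw [← ENat.natCast_le_natCast, ENat.natCast_toNat hL.ne, Set.Finite.cast_ncard_eq (Set.toFinite _)]
    have hbound : max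
        (⨆ j ∈ Set.Iic (⟨n, hn⟩ : ℕ+), {i : ℕ+ | i ≤ ⟨n, hn⟩ ∧ L (i, j) = t}.encard)
        (⨆ i ∈ Set.Iic (⟨n, hn⟩ : ℕ+), {j : ℕ+ | j ≤ ⟨n, hn⟩ ∧ L (i, j) = t}.encard) ≤
        maxMultiplicity L :=
      le_iSup_of_le (⟨n, hn⟩ : ℕ+) (le_iSup₂_of_le t ht le_rfl)
    rw [← (hinj _).encard_image]
    -- A forward step fixes the row, a backward step the column; these are the two halves of the
    -- maximum.
    cases e
    · refine le_trans ?_ ((le_max_right _ _).trans hbound)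
      refine le_trans ?_ (le_iSup₂_of_le (Nat.succPNat u) (hle u) le_rfl)
      refine Set.encard_le_encard ?_
      rintro _ ⟨v, hv, rfl⟩
      exact ⟨hle v, hv⟩
    · refine le_trans ?_ ((le_max_left _ _).trans hbound)
      refine le_trans ?_ (le_iSup₂_of_le (Nat.succPNat u) (hle u) le_rfl)
      refine Set.encard_le_encard ?_
      rintro _ ⟨v, hv, rfl⟩
      exact ⟨hle v, hv⟩
  · have : {v | linkLabel L n (stepEdge e u v) = t} = ∅ := by
      ext v
      simp only [Set.mem_ofPred_eq, Set.mem_empty_iff_false, iff_false]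
      rintro rfl
      exact ht ⟨_, rfl⟩
    rw [this, Set.ncard_empty]
    exact Nat.zero_le _

theorem injective_linkLabel {LX : ℕ+ × ℕ+ → Fin d → ℤ} {LY : ℕ+ × ℕ+ → Fin d' → ℤ}
    (hinj : Function.Injective fun ij => (LX ij, LY ij)) (n : ℕ) :
    Function.Injective fun e => (linkLabel LX n e, linkLabel LY n e) := by
  intro e e' h
  have := hinj h
  rw [Prod.mk.injEq] at this
  exact Prod.ext (Fin.ext (Nat.succPNat_injective this.1))
    (Fin.ext (Nat.succPNat_injective this.2))

variable {Ω : Type*} [MeasurableSpace Ω] {P : Measure Ω} [IsProbabilityMeasure P]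
  (LX : ℕ+ × ℕ+ → Fin d → ℤ) (LY : ℕ+ × ℕ+ → Fin d' → ℤ)
  (x : (Fin d → ℤ) → LInfMinus P) (y : (Fin d' → ℤ) → LInfMinus P)

theorem scaledProduct_entry (n : ℕ) (e : Bool) (u v : Fin n) (ω : Ω) :
    (((if e then star (scaledProduct LX LY x y n) else scaledProduct LX LY x y n) u v :
      LInfMinus P) : Ω → ℂ) ω = (Real.sqrt n : ℂ)⁻¹ *
      conjIf e ((x (linkLabel LX n (stepEdge e u v)) : Ω → ℂ) ω *
        (y (linkLabel LY n (stepEdge e u v)) : Ω → ℂ) ω) := by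
  cases e
  · rfl
  · change star ((Real.sqrt n : ℂ)⁻¹ * (_ * _)) = _ * star (_ * _)
    rw [star_mul', star_inv₀]
    congr 2
    exact Complex.conj_ofReal _

theorem LInfMinus.coe_prod_apply {ι : Type*} (s : Finset ι) (f : ι → LInfMinus P) (ω : Ω) :
    ((∏ i ∈ s, f i : LInfMinus P) : Ω → ℂ) ω = ∏ i ∈ s, (f i : Ω → ℂ) ω := by
  classical
  induction s using Finset.induction_on with
  | empty => rfl
  | insert i s hi ih =>
    rw [Finset.prod_insert hi, Finset.prod_insert hi, ← ih]
    rfl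

variable {LX LY x y}

theorem expTrace_word (hxy : IndepFun (fun ω α => (x α : Ω → ℂ) ω)
      (fun ω β => (y β : Ω → ℂ) ω) P) (n m : ℕ) (ε : ZMod (m + 1) → Bool) :
    expTrace P n ((List.ofFn fun r : Fin (m + 1) => zmodSeq ε r).map fun e =>
      if e then star (scaledProduct LX LY x y n) else scaledProduct LX LY x y n).prod =
    (n : ℂ)⁻¹ * ((Real.sqrt n : ℂ)⁻¹ ^ (m + 1) * ∑ g : ZMod (m + 1) → Fin n,
      (∫ ω, ∏ r, conjIf (ε r) ((x (linkLabel LX n (closedEdge ε g r)) : Ω → ℂ) ω) ∂P) *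
        ∫ ω, ∏ r, conjIf (ε r) ((y (linkLabel LY n (closedEdge ε g r)) : Ω → ℂ) ω) ∂P) := by
  have hε : ∀ r : Fin (m + 1), zmodSeq ε r = ε r := fun r => by
    unfold zmodSeq
    congr 1
    exact Fin.cast_val_eq_self r
  rw [List.map_ofFn]
  change (n : ℂ)⁻¹ * expectation P
    (Matrix.trace (List.prod _ : Matrix (Fin n) (Fin n) (LInfMinus P))) = _
  rw [trace_prod_ofFn, map_sum]
  congr 1
  rw [Finset.mul_sum]
  refine Finset.sum_congr rfl fun g _ => ?_
  rw [← integral_prod_mul_eq hxy ε (fun r => linkLabel LX n (closedEdge ε g r))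
    fun r => linkLabel LY n (closedEdge ε g r), ← integral_const_mul]
  change ∫ ω, _ ∂P = _
  refine integral_congr_ae (Eventually.of_forall fun ω => ?_)
  rw [LInfMinus.coe_prod_apply]
  have hentry := fun r : ZMod (m + 1) =>
    scaledProduct_entry LX LY x y n (ε r) (g r) (g (r + 1)) ω
  simp only [hε]
  refine (Finset.prod_congr rfl fun r _ => hentry r).trans ?_
  rw [Finset.prod_mul_distrib, Finset.prod_const, Finset.card_univ, ZMod.card]
  rfl

end Matrices

/-! ### Convergence of the moments and conclusion -/

theorem tendsto_expTrace_word {Ω : Type*} [MeasurableSpace Ω] {P : Measure Ω}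
    [IsProbabilityMeasure P] {d d' : ℕ}
    {LX : ℕ+ × ℕ+ → Fin d → ℤ} {LY : ℕ+ × ℕ+ → Fin d' → ℤ}
    {x : (Fin d → ℤ) → LInfMinus P} {y : (Fin d' → ℤ) → LInfMinus P}
    (hx : IsInputFamily x) (hy : IsInputFamily y)
    (hxy : IndepFun (fun ω α => (x α : Ω → ℂ) ω) (fun ω β => (y β : Ω → ℂ) ω) P)
    (hLX : maxMultiplicity LX < ⊤) (hLY : maxMultiplicity LY < ⊤)
    (hinj : Function.Injective fun ij => (LX ij, LY ij)) (w : List Bool) :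
    Tendsto (fun n => expTrace P n (w.map fun e =>
      if e then star (scaledProduct LX LY x y n) else scaledProduct LX LY x y n).prod) atTop
      (𝓝 (stackCount w [] : ℂ)) := by
  rcases hw : w.length with _ | m
  · obtain rfl := List.length_eq_zero_iff.1 hw
    refine tendsto_const_nhds.congr' ?_
    -- The empty word has normalised trace `1` only for `n > 0`, as `0⁻¹ = 0`.
    filter_upwards [eventually_gt_atTop 0] with n hn
    have hn' : (n : ℂ) ≠ 0 := by exact_mod_cast hn.ne'
    have h1 : ∫ ω, ((n : LInfMinus P) : Ω → ℂ) ω ∂P = n := by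
      have : ((n : LInfMinus P) : Ω → ℂ) = fun _ => (n : ℂ) := rfl
      rw [this, integral_const]
      simp
    change _ = (n : ℂ)⁻¹ * ∫ ω, ((Matrix.trace (1 : Matrix (Fin n) (Fin n) (LInfMinus P)) :
      LInfMinus P) : Ω → ℂ) ω ∂P
    rw [Matrix.trace_one, Fintype.card_fin, h1, inv_mul_cancel₀ hn']
    simp [stackCount]
  · obtain ⟨ε, hε⟩ : ∃ ε : ZMod (m + 1) → Bool,
        w = List.ofFn fun r : Fin (m + 1) => zmodSeq ε r := by
      -- The default `false` is never reached, since `q.val < m + 1 = w.length`.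
      refine ⟨fun q => w.getD q.val false, List.ext_getElem (by simp [hw]) fun r h1 h2 => ?_⟩
      rw [List.getElem_ofFn]
      simp only [zmodSeq]
      rw [ZMod.val_cast_of_lt (by omega)]
      simp [h1]
    obtain ⟨BX, hBX⟩ := hx.exists_isMomentFunction ε
    obtain ⟨BY, hBY⟩ := hy.exists_isMomentFunction ε
    rw [hε]
    simp only [expTrace_word hxy]
    refine tendsto_normalized_sum (C := (BX * BY + 2 ^ (m + 1)) * ((m + 1 : ℕ) *
      (1 + m * ((maxMultiplicity LX).toNat + (maxMultiplicity LY).toNat + 1) : ℕ) ^ m)) _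
      fun n => ?_
    have := norm_sum_sub_stackCount_le (boundedMultiplicity_linkLabel hLX n)
      (boundedMultiplicity_linkLabel hLY n) (injective_linkLabel hinj n) hBX hBY
    rwa [Fintype.card_fin] at this

end StarProb

theorem mainTheorem2 {Ω : Type*} [MeasurableSpace Ω] (P : MeasureTheory.Measure Ω)
    [MeasureTheory.IsProbabilityMeasure P] {d d' : ℕ}
    (LX : ℕ+ × ℕ+ → Fin d → ℤ) (LY : ℕ+ × ℕ+ → Fin d' → ℤ)
    (x : (Fin d → ℤ) → StarProb.LInfMinus P) (y : (Fin d' → ℤ) → StarProb.LInfMinus P)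
    (hx : StarProb.IsInputFamily x) (hy : StarProb.IsInputFamily y)
    (hxy : ProbabilityTheory.IndepFun (fun ω α => (x α : Ω → ℂ) ω)
      (fun ω β => (y β : Ω → ℂ) ω) P)
    (hLX : StarProb.maxMultiplicity LX < ⊤) (hLY : StarProb.maxMultiplicity LY < ⊤)
    (hinj : Function.Injective fun ij => (LX ij, LY ij)) :
    ∃ (A : Type) (_ : Ring A) (_ : StarRing A) (_ : Algebra ℂ A) (_ : StarModule ℂ A)
      (φ : A →ₗ[ℂ] ℂ) (c : A), StarProb.IsState φ ∧ StarProb.IsCircular φ c ∧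
      StarProb.ConvergesInStarDistribution (StarProb.expTrace P)
        (StarProb.scaledProduct LX LY x y) φ c := by
  have hF := StarProb.isFreeCreation_star_annihilation
  refine ⟨lp (fun _ : List Bool => ℂ) 2 →L[ℂ] lp (fun _ : List Bool => ℂ) 2, inferInstance,
    inferInstance, inferInstance, inferInstance, StarProb.vectorState StarProb.vacuum, _,
    StarProb.isState_vectorState hF.inner_vacuum, hF.isCircular,
    StarProb.convergesInStarDistribution_of_words _ _ _ _ fun w => ?_⟩
  have h := hF.inner_word w []
  rw [List.map_nil, List.prod_nil] at h
  rw [StarProb.vectorState_apply]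
  refine Eq.subst (motive := fun z => Tendsto _ atTop (𝓝 z)) h.symm ?_
  exact StarProb.tendsto_expTrace_word hx hy hxy hLX hLY hinj w
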